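/- Let $\mathcal P^1$ be the class of the potential equations $\mathcal P_{f,\lambda}$, $v_t+\frac1{2\lambda}v_x^2+fv_{xx}=0$, of the Burgers equations with constant $f\neq0$, where $\lambda\ne0$ is constant because $\lambda_t=f_{xx}\lambda=0$. In the gauge $\lambda=1$ the arbitrary element is $f$ and the equations are $v_t+\frac12v_x^2+fv_{xx}=0$. We work within the local framework: a point transformation is a smooth map with nonvanishing Jacobian on an open domain, and it maps one equation to another if it transforms smooth solutions exactly to smooth solutions. The generalized equivalence (pseudo)group of the class consists of the point transformations of the space $(t,x,v,f)$, with all components allowed to depend on all these variables, that map each equation of the class (with a value of $f$ met by the domain) to an equation of the same class. (i) The class $\mathcal P^1$ is normalized in the generalized sense: for all nonzero constants $f_0,\tilde f_0$ and each point transformation $\varphi$ mapping the equation with $f=f_0$ to the one with $f=\tilde f_0$, there is a transformation from the generalized equivalence group, acting on all equations of the class, whose restriction to $f=f_0$ is $(\varphi,\tilde f_0)$. (ii) A point transformation of the space $(t,x,v,f)$, $f\ne0$, for which the part of the domain with each fixed value of $f$ is convex, belongs to the generalized equivalence group if and only if it is of the form $$\tilde t=\frac{\alpha t+\beta}{\gamma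 t+\delta},\qquad \tilde x=\frac{\kappa x+\mu_1t+\mu_0}{\gamma t+\delta},\qquad \tilde v=\frac{2\kappa^2f}{\Delta}\ln\left|F^1\Big(e^{\frac{v}{2f}}+F^0\Big)\right|,\qquad \tilde f=\frac{\kappa^2}{\Delta}f,$$ where, for each fixed value of $f$ (on which all the parameters may depend), $\alpha,\beta,\gamma,\delta,\kappa,\mu_1,\mu_0$ are constants with $\Delta:=\alpha\delta-\beta\gamma\ne0$ and $\kappa\neq0$, $$F^1=\begin{cases}k\sqrt{|\gamma t+\delta|}\,\exp\left(-\dfrac{(\gamma\kappa x-\mu_1\delta+\mu_0\gamma)^2}{4f\kappa^2\gamma(\gamma t+\delta)}\right),&\gamma\ne0,\\[3mm] k\exp\dfrac{2\kappa\mu_1x+\mu_1^2t}{4\kappa^2f},&\gamma=0,\end{cases}$$ $k$ is a nonzero constant, $F^0=F^0(t,x)$ is a smooth solution of $F^0_t+fF^0_{xx}=0$, and $\gamma t+\delta$ and $e^{v/(2f)}+F^0$ do not vanish on the domain. (iii) The tuple $(\alpha,\beta,\gamma,\delta,\kappa,\mu_1,\mu_0)$ is defined by the transformation, for each fixed $f$,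 exactly up to a nonzero multiplier. If the gauge $\lambda=1$ is not fixed, i.e., the arbitrary element is the pair $(f,\lambda)$ of nonzero constants and $\lambda$ is adjoined to the variables as well, then (i)–(iii) hold with $f$ replaced by $(f,\lambda)$ as the arbitrary element, with $\tilde v=\frac{2\kappa^2f\tilde\lambda}{\Delta}\ln\big|F^1\big(e^{v/(2f\lambda)}+F^0\big)\big|$, the same $\tilde t,\tilde x,\tilde f,F^1$ and the same equation for $F^0$, where $\tilde\lambda$ is a nonzero constant for each fixed $(f,\lambda)$. -/

import Mathlib

open scoped ContDiff

noncomputable section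

namespace PotBurgers

/-- The space of the variables `(t, x, v)`. -/
abbrev Space : Type := ℝ × ℝ × ℝ

/-- The partial derivative with respect to `t` of a function of `(t, x)`. -/
def dt (v : ℝ × ℝ → ℝ) : ℝ × ℝ → ℝ := fun p => deriv (fun s => v (s, p.2)) p.1

/-- The partial derivative with respect to `x` of a function of `(t, x)`. -/
def dx (v : ℝ × ℝ → ℝ) : ℝ × ℝ → ℝ := fun p => deriv (fun y => v (p.1, y)) p.2

/-- `v` is a smooth solution on `D` of the potential equation
`v_t + v_x ^ 2 / (2 λ) + f v_xx - f_x v_x = 0` with `f = f(t, x)` and `λ = λ(t)`. -/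
def IsPotentialSolution (f : ℝ × ℝ → ℝ) (lam : ℝ → ℝ) (v : ℝ × ℝ → ℝ) (D : Set (ℝ × ℝ)) : Prop :=
  ContDiffOn ℝ ∞ v D ∧
    ∀ p ∈ D, dt v p + 1 / (2 * lam p.1) * dx v p ^ 2 + f p * dx (dx v) p - dx f p * dx v p = 0

/-- `w` is a smooth solution on `D` of the linear equation `w_t + f w_xx = 0`, `f` constant. -/
def IsHeatSolution (f : ℝ) (w : ℝ × ℝ → ℝ) (D : Set (ℝ × ℝ)) : Prop :=
  ContDiffOn ℝ ∞ w D ∧ ∀ p ∈ D, dt w p + f * dx (dx w) p = 0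

/-- A point transformation with domain `Ω`: a smooth map with nonvanishing Jacobian. -/
def IsPointTransformation {H : Type*} [NormedAddCommGroup H] [NormedSpace ℝ H]
    (φ : H → H) (Ω : Set H) : Prop :=
  IsOpen Ω ∧ ContDiffOn ℝ ∞ φ Ω ∧ ∀ p ∈ Ω, (fderiv ℝ φ p).det ≠ 0

/-- The graph of `v` over `D`, as a surface in the space of `(t, x, v)`. -/
def graphOver (v : ℝ × ℝ → ℝ) (D : Set (ℝ × ℝ)) : Set Space :=
  (fun p : ℝ × ℝ => ((p.1, p.2, v p) : Space)) '' D

/-- The point transformation `φ` with domain `Ω` maps the potential equation with constant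
arbitrary elements `(f, lam)` to the one with `(f', lam')`: whenever it maps the graph of a smooth
function `v` onto the graph of a smooth function `v'`, the function `v` is a solution of the first
equation if and only if `v'` is a solution of the second one. -/
def MapsEquation (f lam f' lam' : ℝ) (φ : Space → Space) (Ω : Set Space) : Prop :=
  IsPointTransformation φ Ω ∧
    ∀ (D D' : Set (ℝ × ℝ)) (v v' : ℝ × ℝ → ℝ), IsOpen D → IsOpen D' →
      ContDiffOn ℝ ∞ v D → ContDiffOn ℝ ∞ v' D' →
      graphOver v D ⊆ Ω → φ '' graphOver v D = graphOver v' D' →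
      (IsPotentialSolution (fun _ => f) (fun _ => lam) v D ↔
        IsPotentialSolution (fun _ => f') (fun _ => lam') v' D')

/-- A class of potential equations with constant arbitrary elements: `S` is the set run by the
arbitrary element `θ`, which belongs to the space `E`, and the equation corresponding to `θ` is the
potential equation with the constants `f θ` and `lam θ`. -/
structure EqClass (E : Type) where
  S : Set E
  f : E → ℝ
  lam : E → ℝ

/-- The potential equations with constant `f ≠ 0`, in the gauge `λ = 1`;
the arbitrary element is `f`. -/
def classP1 : EqClass ℝ where
  S := {f | f ≠ 0}
  f := fun f => f
  lam := fun _ => 1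

/-- The potential equations with constant `f ≠ 0` and without fixing a gauge for `λ` (since
`f_xx = 0`, the condition `λ_t = f_xx λ` makes `λ` a nonzero constant); the arbitrary element is
the pair `(f, λ)`. -/
def classP1ext : EqClass (ℝ × ℝ) where
  S := {θ | θ.1 ≠ 0 ∧ θ.2 ≠ 0}
  f := fun θ => θ.1
  lam := fun θ => θ.2

/-- The part of `O` with a fixed value of the arbitrary element. -/
def slice {E : Type} (O : Set (Space × E)) (θ : E) : Set Space := {q | (q, θ) ∈ O}

section Classes

variable {E : Type} [NormedAddCommGroup E] [NormedSpace ℝ E]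

/-- `A` with domain `O` belongs to the generalized equivalence (pseudo)group of the class: it is a
point transformation in the extended space of `(t, x, v, θ)` (all the components of which may depend
on all of `(t, x, v, θ)`), and it maps each equation of the class, with a value `θ` of the arbitrary
element that is met by `O`, to an equation of the same class. -/
def EqClass.IsGenEquiv (C : EqClass E) (A : Space × E → Space × E) (O : Set (Space × E)) : Prop :=
  IsPointTransformation A O ∧ (∀ p ∈ O, p.2 ∈ C.S) ∧
    ∀ θ ∈ C.S, ∃ θ' ∈ C.S, (∀ q ∈ slice O θ, (A (q, θ)).2 = θ') ∧
      MapsEquation (C.f θ) (C.lam θ) (C.f θ') (C.lam θ') (fun q => (A (q, θ)).1) (slice O θ)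

/-- The class is normalized in the generalized sense: each admissible transformation `(θ, φ, θ')`
of the class is induced by an element of the generalized equivalence group. That element is
required to act on all the equations of the class. -/
def EqClass.IsNormalizedGen (C : EqClass E) : Prop :=
  ∀ θ ∈ C.S, ∀ θ' ∈ C.S, ∀ (φ : Space → Space) (Ω : Set Space), Ω.Nonempty →
    MapsEquation (C.f θ) (C.lam θ) (C.f θ') (C.lam θ') φ Ω →
    ∃ (A : Space × E → Space × E) (O : Set (Space × E)), C.IsGenEquiv A O ∧
      (∀ η ∈ C.S, (slice O η).Nonempty) ∧ slice O θ = Ω ∧ ∀ q ∈ Ω, A (q, θ) = (φ q, θ')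

end Classes

/-- The constants `α, β, γ, δ, κ, μ₁, μ₀`. -/
@[ext]
structure Params where
  α : ℝ
  β : ℝ
  γ : ℝ
  δ : ℝ
  κ : ℝ
  μ₁ : ℝ
  μ₀ : ℝ

/-- `Δ = α δ - β γ`. -/
def Params.Δ (P : Params) : ℝ := P.α * P.δ - P.β * P.γ

/-- All seven constants are multiplied by `c`. -/
def Params.scale (c : ℝ) (P : Params) : Params :=
  ⟨c * P.α, c * P.β, c * P.γ, c * P.δ, c * P.κ, c * P.μ₁, c * P.μ₀⟩

/-- The function `F¹` of `(t, x)`. -/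
def Params.F1 (P : Params) (k f t x : ℝ) : ℝ :=
  if P.γ = 0 then
    k * Real.exp ((2 * P.κ * P.μ₁ * x + P.μ₁ ^ 2 * t) / (4 * P.κ ^ 2 * f))
  else
    k * Real.sqrt |P.γ * t + P.δ| *
      Real.exp (-((P.γ * P.κ * x - P.μ₁ * P.δ + P.μ₀ * P.γ) ^ 2 /
        (4 * f * P.κ ^ 2 * P.γ * (P.γ * t + P.δ))))

/-- On `Ω`, the map `φ` from the source equation with the constants `(f, lam)` to the target
equation with the constants `(f', lam')` is well defined by the explicit formulas with the constants
`P` and `k` and with the solution `F0` of the linear equation `F0_t + f F0_xx = 0`. -/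
structure HasForm (f lam f' lam' : ℝ) (φ : Space → Space) (Ω : Set Space)
    (P : Params) (k : ℝ) (F0 : ℝ × ℝ → ℝ) : Prop where
  Δ_ne : P.Δ ≠ 0
  κ_ne : P.κ ≠ 0
  k_ne : k ≠ 0
  heat : IsHeatSolution f F0 ((fun q : Space => (q.1, q.2.1)) '' Ω)
  denom_ne : ∀ t x v, (t, x, v) ∈ Ω → P.γ * t + P.δ ≠ 0
  log_ne : ∀ t x v, (t, x, v) ∈ Ω → Real.exp (v / (2 * f * lam)) + F0 (t, x) ≠ 0
  eq_f : f' = P.κ ^ 2 / P.Δ * f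
  eq_φ : ∀ t x v, (t, x, v) ∈ Ω → φ (t, x, v) =
    ((P.α * t + P.β) / (P.γ * t + P.δ),
      (P.κ * x + P.μ₁ * t + P.μ₀) / (P.γ * t + P.δ),
      2 * P.κ ^ 2 * f / P.Δ * lam' *
        Real.log |P.F1 k f t x * (Real.exp (v / (2 * f * lam)) + F0 (t, x))|)

/-- The transformation `A` of the extended space is given on `O` by the explicit formulas, for each
value of the arbitrary element. -/
def EqClass.IsExplicit {E : Type} (C : EqClass E) (A : Space × E → Space × E)
    (O : Set (Space × E)) : Prop :=
  ∀ θ ∈ C.S, ∃ θ' ∈ C.S, (∀ q ∈ slice O θ, (A (q, θ)).2 = θ') ∧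
    ∃ (P : Params) (k : ℝ) (F0 : ℝ × ℝ → ℝ),
      HasForm (C.f θ) (C.lam θ) (C.f θ') (C.lam θ') (fun q => (A (q, θ)).1) (slice O θ) P k F0

end PotBurgers

end

/-!
The substitution `w = exp (v / (2 f λ))` turns the potential equation into the linear equation
`w_t + f w_xx = 0` (`coleHopf`), and the whole proof takes place between linear equations.

*Transformations of the explicit form map equations* (`HasForm.mapsEquation`). If `H` is `± F¹` and
`g = X_t / X_x`, then `2 f H_x = g H` and `H_t - g H_x + f H_xx = 0`. Hence the operator
`∂_t - g ∂_x + f ∂_x²` applied to `H Y` gives `H (Y_t + f Y_xx)` (`heat_mul`), while applied to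
`W ∘ (T, X)` it gives `T_t (W_T + f' W_XX)` (`heat_comp`), where `f X_x² = f' T_t`.

*A transformation `(T, X, V)` that maps equations has the explicit form on a convex domain*
(`MapsEquation.exists_hasForm`). Put `W = exp (V / (2 f' λ'))`. Through each point there is a
solution with arbitrary `v_x`, `v_t`, `v_tt` (`exists_solution`), obtained from caloric polynomials.
Two solutions that differ only in `v_tt` show that `T` depends on `t` only
(`SendsSolutions.T_eq_zero`). The transformed equation is then affine in `v_t`; the coefficient of
`v_t` yields `X_v = 0` and `f X_x² = f' T_t`, and the coefficients of the powers of `v_x` yield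
`W_vv = W_v / (2 f λ)`, `2 f W_xv = g W_v` and `W_t - g W_x + f W_xx = 0`
(`SendsSolutions.X_equations`, `SendsSolutions.W_equations`). The compatibility of the equations for
`W_v` is `g_t = g g_x`, which makes `R = 1 / X_x`, `T R` and `X R - x` affine functions of `t`
(`SendsSolutions.exists_params`). Then `W_v` is a constant multiple of `F¹ exp (v / (2 f λ))`, since
the two have the same logarithmic derivatives, and `W / F¹ - exp (v / (2 f λ))` does not depend
on `v`; this is `F⁰`. Connectedness makes the constants global, and convexity of the domain makes
`F⁰` a function of `(t, x)`.

*Normalization* does not need the explicit form: the scalings `(t, x, v) ↦ (t / c, x, c m v)` map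
the equation with `(f, λ)` to the one with `(c f, m λ)`, so a transformation between two equations
is carried over to all the equations of the class by conjugation
(`EqClass.isNormalizedGen_of_scaling`).

*The constants* are unique up to a multiplier because linear fractional functions that agree on an
open set are proportional (`HasForm.params_unique`).
-/

namespace PotBurgers

/-! ### Directional derivatives -/

section Calculus

variable {E : Type*} [NormedAddCommGroup E] [NormedSpace ℝ E]

/-- The derivative of `g` in the direction `e`; it is `0` where `g` is not differentiable. -/
noncomputable def pd (e : E) (g : E → ℝ) (p : E) : ℝ := fderiv ℝ g p e

/-- `g` is differentiable at `p`, with the derivative `g'` in the direction `e`. Differentiability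
is that of the function of all variables, so that the chain rule holds. -/
def HasPd (e : E) (g : E → ℝ) (g' : ℝ) (p : E) : Prop :=
  DifferentiableAt ℝ g p ∧ fderiv ℝ g p e = g'

theorem HasPd.pd_eq {e : E} {g : E → ℝ} {g' : ℝ} {p : E} (h : HasPd e g g' p) : pd e g p = g' := h.2

theorem hasPd_of_differentiableAt {g : E → ℝ} {p : E} (h : DifferentiableAt ℝ g p) (e : E) :
    HasPd e g (pd e g p) p := ⟨h, rfl⟩

theorem hasPd_of_contDiffOn {U : Set E} (hU : IsOpen U) {g : E → ℝ} (hg : ContDiffOn ℝ ∞ g U)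
    (e : E)
    {p : E} (hp : p ∈ U) : HasPd e g (pd e g p) p :=
  hasPd_of_differentiableAt ((hg.contDiffAt (hU.mem_nhds hp)).differentiableAt (by simp)) e

theorem HasPd.of_eq {e : E} {g : E → ℝ} {a b : ℝ} {p : E} (h : HasPd e g a p) (hab : a = b) :
    HasPd e g b p := hab ▸ h

theorem HasPd.congr {e : E} {g h : E → ℝ} {a : ℝ} {p : E} {U : Set E} (hU : IsOpen U) (hp : p ∈ U)
    (hg : HasPd e g a p) (hgh : ∀ q ∈ U, h q = g q) : HasPd e h a p := by
  have : h =ᶠ[nhds p] g := by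
    filter_upwards [hU.mem_nhds hp] with q hq using hgh q hq
  exact ⟨this.differentiableAt_iff.2 hg.1, by rw [this.fderiv_eq]; exact hg.2⟩

theorem pd_congr {e : E} {g h : E → ℝ} {p : E} {U : Set E} (hU : IsOpen U) (hp : p ∈ U)
    (hgh : ∀ q ∈ U, h q = g q) : pd e h p = pd e g p := by
  have : h =ᶠ[nhds p] g := by
    filter_upwards [hU.mem_nhds hp] with q hq using hgh q hq
  simp only [pd, this.fderiv_eq]

theorem HasPd.add {e : E} {g h : E → ℝ} {a b : ℝ} {p : E} (hg : HasPd e g a p)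
    (hh : HasPd e h b p) : HasPd e (fun q => g q + h q) (a + b) p :=
  ⟨hg.1.add hh.1, by rw [fderiv_fun_add hg.1 hh.1]; simp [hg.2, hh.2]⟩

theorem HasPd.sub {e : E} {g h : E → ℝ} {a b : ℝ} {p : E} (hg : HasPd e g a p)
    (hh : HasPd e h b p) : HasPd e (fun q => g q - h q) (a - b) p :=
  ⟨hg.1.sub hh.1, by rw [fderiv_fun_sub hg.1 hh.1]; simp [hg.2, hh.2]⟩

theorem HasPd.mul {e : E} {g h : E → ℝ} {a b : ℝ} {p : E} (hg : HasPd e g a p)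
    (hh : HasPd e h b p) : HasPd e (fun q => g q * h q) (a * h p + g p * b) p :=
  ⟨hg.1.mul hh.1, by
    rw [fderiv_fun_mul hg.1 hh.1]; simp [hg.2, hh.2]; ring⟩

theorem HasPd.const (e : E) (c : ℝ) (p : E) : HasPd e (fun _ => c) 0 p :=
  ⟨differentiableAt_const c, by simp⟩

theorem HasPd.const_mul {e : E} {g : E → ℝ} {a : ℝ} {p : E} (c : ℝ) (hg : HasPd e g a p) :
    HasPd e (fun q => c * g q) (c * a) p :=
  ((HasPd.const e c p).mul hg).of_eq (by ring)

theorem HasPd.comp1 {e : E} {g : E → ℝ} {a b : ℝ} {p : E} {F : ℝ → ℝ} (hF : HasDerivAt F b (g p))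
    (hg : HasPd e g a p) : HasPd e (fun q => F (g q)) (b * a) p := by
  have h := hF.hasFDerivAt.comp p hg.1.hasFDerivAt
  refine ⟨h.differentiableAt, ?_⟩
  have h2 : fderiv ℝ (fun q => F (g q)) p = _ := h.fderiv
  rw [h2]
  simp [hg.2, mul_comm]

theorem HasPd.inv {e : E} {g : E → ℝ} {a : ℝ} {p : E} (hg : HasPd e g a p) (h0 : g p ≠ 0) :
    HasPd e (fun q => (g q)⁻¹) (-a / g p ^ 2) p :=
  (HasPd.comp1 (hasDerivAt_inv h0) hg).of_eq (by field_simp)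

theorem HasPd.div {e : E} {g h : E → ℝ} {a b : ℝ} {p : E} (hg : HasPd e g a p)
    (hh : HasPd e h b p) (h0 : h p ≠ 0) :
    HasPd e (fun q => g q / h q) ((a * h p - g p * b) / h p ^ 2) p := by
  simp only [div_eq_mul_inv]
  exact (hg.mul (hh.inv h0)).of_eq (by field_simp; ring)

theorem HasPd.exp {e : E} {g : E → ℝ} {a : ℝ} {p : E} (hg : HasPd e g a p) :
    HasPd e (fun q => Real.exp (g q)) (Real.exp (g p) * a) p :=
  HasPd.comp1 (Real.hasDerivAt_exp _) hg

theorem HasPd.log {e : E} {g : E → ℝ} {a : ℝ} {p : E} (hg : HasPd e g a p) (h0 : g p ≠ 0) :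
    HasPd e (fun q => Real.log (g q)) (a / g p) p :=
  (HasPd.comp1 (Real.hasDerivAt_log h0) hg).of_eq (by field_simp)

theorem contDiffOn_pd {U : Set E} (hU : IsOpen U) {g : E → ℝ} (hg : ContDiffOn ℝ ∞ g U) (e : E) :
    ContDiffOn ℝ ∞ (pd e g) U := by
  have h := hg.fderiv_of_isOpen hU (m := ∞) (by simp)
  exact h.clm_apply contDiffOn_const

theorem pd_comm {U : Set E} (hU : IsOpen U) {g : E → ℝ} (hg : ContDiffOn ℝ ∞ g U) (e e' : E)
    {p : E} (hp : p ∈ U) : pd e (pd e' g) p = pd e' (pd e g) p := by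
  have hg' := hg.contDiffAt (hU.mem_nhds hp)
  have hs : IsSymmSndFDerivAt ℝ g p := hg'.isSymmSndFDerivAt (by
    simp only [minSmoothness_of_isRCLikeNormedField]; exact WithTop.coe_le_coe.2 le_top)
  have hd : DifferentiableAt ℝ (fderiv ℝ g) p :=
    ((hg.fderiv_of_isOpen hU (m := ∞) (by simp)).contDiffAt (hU.mem_nhds hp)).differentiableAt
      (by simp)
  have key : ∀ e e' : E, pd e (pd e' g) p = fderiv ℝ (fderiv ℝ g) p e e' := by
    intro e e'
    have : fderiv ℝ (fun q => fderiv ℝ g q e') p e = _ :=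
      congrArg (fun L => L e) (fderiv_clm_apply hd (differentiableAt_const e'))
    have h2 : pd e (pd e' g) p = fderiv ℝ (fun q => fderiv ℝ g q e') p e := rfl
    rw [h2, this]
    simp
  rw [key, key]
  exact hs e e'

theorem HasPd.unique {e : E} {g : E → ℝ} {a b : ℝ} {p : E} (h : HasPd e g a p)
    (h' : HasPd e g b p) : a = b := h.2.symm.trans h'.2

end Calculus

/-! ### The chain rule in two and three variables -/

theorem hasPd_fst (e p : ℝ × ℝ) : HasPd e (fun q => q.1) e.1 p :=
  ⟨differentiableAt_fst, by
    have : fderiv ℝ (fun q : ℝ × ℝ => q.1) p = _ := fderiv_fst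
    rw [this]; rfl⟩

theorem hasPd_snd (e p : ℝ × ℝ) : HasPd e (fun q => q.2) e.2 p :=
  ⟨differentiableAt_snd, by
    have : fderiv ℝ (fun q : ℝ × ℝ => q.2) p = _ := fderiv_snd
    rw [this]; rfl⟩

section Chain

variable {E : Type*} [NormedAddCommGroup E] [NormedSpace ℝ E]

theorem HasPd.comp2 {e : E} {a b : E → ℝ} {a' b' : ℝ} {p : E} {h : ℝ × ℝ → ℝ}
    (hh : DifferentiableAt ℝ h (a p, b p)) (ha : HasPd e a a' p) (hb : HasPd e b b' p) :
    HasPd e (fun q => h (a q, b q))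
      (pd (1, 0) h (a p, b p) * a' + pd (0, 1) h (a p, b p) * b') p := by
  have h1 : HasFDerivAt (fun q => (a q, b q)) _ p :=
    ha.1.hasFDerivAt.prodMk hb.1.hasFDerivAt
  have h2 := HasFDerivAt.comp p (g := h) hh.hasFDerivAt h1
  refine ⟨h2.differentiableAt, ?_⟩
  have h3 : fderiv ℝ (fun q => h (a q, b q)) p = _ := h2.fderiv
  rw [h3]
  have h4 : ((a', b') : ℝ × ℝ) = a' • ((1, 0) : ℝ × ℝ) + b' • ((0, 1) : ℝ × ℝ) := by simp
  simp only [ContinuousLinearMap.comp_apply, ContinuousLinearMap.prod_apply, ha.2, hb.2]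
  rw [h4, map_add, map_smul, map_smul]
  simp [pd, mul_comm]

theorem HasPd.comp3 {e : E} {a b c : E → ℝ} {a' b' c' : ℝ} {p : E} {h : Space → ℝ}
    (hh : DifferentiableAt ℝ h (a p, b p, c p)) (ha : HasPd e a a' p) (hb : HasPd e b b' p)
    (hc : HasPd e c c' p) :
    HasPd e (fun q => h (a q, b q, c q))
      (pd (1, 0, 0) h (a p, b p, c p) * a' + pd (0, 1, 0) h (a p, b p, c p) * b' +
        pd (0, 0, 1) h (a p, b p, c p) * c') p := by
  have h1 : HasFDerivAt (fun q => (a q, b q, c q)) _ p :=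
    ha.1.hasFDerivAt.prodMk (hb.1.hasFDerivAt.prodMk hc.1.hasFDerivAt)
  have h2 := HasFDerivAt.comp p (g := h) hh.hasFDerivAt h1
  refine ⟨h2.differentiableAt, ?_⟩
  have h3 : fderiv ℝ (fun q => h (a q, b q, c q)) p = _ := h2.fderiv
  rw [h3]
  have h4 : ((a', b', c') : Space) =
      a' • ((1, 0, 0) : Space) + b' • ((0, 1, 0) : Space) + c' • ((0, 0, 1) : Space) := by simp
  simp only [ContinuousLinearMap.comp_apply, ContinuousLinearMap.prod_apply, ha.2, hb.2, hc.2]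
  rw [h4, map_add, map_add, map_smul, map_smul, map_smul]
  simp [pd, mul_comm]

end Chain

theorem HasPd.dt_eq {v : ℝ × ℝ → ℝ} {a : ℝ} {p : ℝ × ℝ} (h : HasPd (1, 0) v a p) : dt v p = a := by
  have h1 : HasDerivAt (fun s : ℝ => ((s, p.2) : ℝ × ℝ)) (1, 0) p.1 :=
    (hasDerivAt_id p.1).prodMk (hasDerivAt_const p.1 p.2)
  have h2 : HasFDerivAt v (fderiv ℝ v p) (p.1, p.2) := h.1.hasFDerivAt
  have := (h2.comp_hasDerivAt p.1 h1).deriv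
  rw [h.2] at this
  exact this

theorem HasPd.dx_eq {v : ℝ × ℝ → ℝ} {a : ℝ} {p : ℝ × ℝ} (h : HasPd (0, 1) v a p) : dx v p = a := by
  have h1 : HasDerivAt (fun s : ℝ => ((p.1, s) : ℝ × ℝ)) (0, 1) p.2 :=
    (hasDerivAt_const p.2 p.1).prodMk (hasDerivAt_id p.2)
  have h2 : HasFDerivAt v (fderiv ℝ v p) (p.1, p.2) := h.1.hasFDerivAt
  have := (h2.comp_hasDerivAt p.2 h1).deriv
  rw [h.2] at this
  exact this

theorem dt_eq_pd {D : Set (ℝ × ℝ)} (hD : IsOpen D) {v : ℝ × ℝ → ℝ} (hv : ContDiffOn ℝ ∞ v D)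
    {p : ℝ × ℝ} (hp : p ∈ D) : dt v p = pd (1, 0) v p := (hasPd_of_contDiffOn hD hv _ hp).dt_eq

theorem dx_eq_pd {D : Set (ℝ × ℝ)} (hD : IsOpen D) {v : ℝ × ℝ → ℝ} (hv : ContDiffOn ℝ ∞ v D)
    {p : ℝ × ℝ} (hp : p ∈ D) : dx v p = pd (0, 1) v p := (hasPd_of_contDiffOn hD hv _ hp).dx_eq

theorem dxdx_eq_pd {D : Set (ℝ × ℝ)} (hD : IsOpen D) {v : ℝ × ℝ → ℝ} (hv : ContDiffOn ℝ ∞ v D)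
    {p : ℝ × ℝ} (hp : p ∈ D) : dx (dx v) p = pd (0, 1) (pd (0, 1) v) p :=
  (HasPd.congr hD hp (hasPd_of_contDiffOn hD (contDiffOn_pd hD hv (0, 1)) (0, 1) hp)
    (fun _ hq => dx_eq_pd hD hv hq)).dx_eq

/-! ### The potential equation and the linear equation -/

theorem isHeatSolution_iff {f : ℝ} {D : Set (ℝ × ℝ)} (hD : IsOpen D) {w : ℝ × ℝ → ℝ}
    (hw : ContDiffOn ℝ ∞ w D) :
    IsHeatSolution f w D ↔ ∀ p ∈ D, pd (1, 0) w p + f * pd (0, 1) (pd (0, 1) w) p = 0 := by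
  refine ⟨fun h p hp => ?_, fun h => ⟨hw, fun p hp => ?_⟩⟩
  · rw [← dt_eq_pd hD hw hp, ← dxdx_eq_pd hD hw hp]; exact h.2 p hp
  · rw [dt_eq_pd hD hw hp, dxdx_eq_pd hD hw hp]; exact h p hp

theorem isPotentialSolution_iff {f lam : ℝ} {D : Set (ℝ × ℝ)} (hD : IsOpen D) {v : ℝ × ℝ → ℝ}
    (hv : ContDiffOn ℝ ∞ v D) :
    IsPotentialSolution (fun _ => f) (fun _ => lam) v D ↔
      ∀ p ∈ D, pd (1, 0) v p + 1 / (2 * lam) * pd (0, 1) v p ^ 2 +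
        f * pd (0, 1) (pd (0, 1) v) p = 0 := by
  have h0 : ∀ p : ℝ × ℝ, dx (fun _ => f) p = 0 := fun p => by simp [dx]
  refine ⟨fun h p hp => ?_, fun h => ⟨hv, fun p hp => ?_⟩⟩
  · have := h.2 p hp
    rw [h0, dt_eq_pd hD hv hp, dx_eq_pd hD hv hp, dxdx_eq_pd hD hv hp] at this
    linarith
  · rw [h0, dt_eq_pd hD hv hp, dx_eq_pd hD hv hp, dxdx_eq_pd hD hv hp]
    linarith [h p hp]

/-- The Hopf-Cole substitution `w = exp (v / (2 f λ))` turns the left-hand side of the potential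
equation into that of the linear equation, up to a nonvanishing factor. -/
theorem coleHopf {f lam : ℝ} (hf : f ≠ 0) (hl : lam ≠ 0) {D : Set (ℝ × ℝ)} (hD : IsOpen D)
    {v : ℝ × ℝ → ℝ} (hv : ContDiffOn ℝ ∞ v D) {p : ℝ × ℝ} (hp : p ∈ D) :
    pd (1, 0) (fun q => Real.exp (v q / (2 * f * lam))) p +
      f * pd (0, 1) (pd (0, 1) (fun q => Real.exp (v q / (2 * f * lam)))) p =
    Real.exp (v p / (2 * f * lam)) / (2 * f * lam) *
      (pd (1, 0) v p + 1 / (2 * lam) * pd (0, 1) v p ^ 2 + f * pd (0, 1) (pd (0, 1) v) p) := by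
  have h1 : ∀ e : ℝ × ℝ, ∀ q ∈ D, HasPd e (fun q => Real.exp (v q / (2 * f * lam)))
      (Real.exp (v q / (2 * f * lam)) * ((2 * f * lam)⁻¹ * pd e v q)) q := by
    intro e q hq
    have := ((hasPd_of_contDiffOn hD hv e hq).const_mul (2 * f * lam)⁻¹).exp
    simpa only [div_eq_inv_mul] using this
  have h2 := HasPd.congr hD hp ((h1 (0, 1) p hp).mul
    ((hasPd_of_contDiffOn hD (contDiffOn_pd hD hv (0, 1)) (0, 1) hp).const_mul (2 * f * lam)⁻¹))
    (fun q hq => (h1 (0, 1) q hq).pd_eq)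
  rw [(h1 (1, 0) p hp).pd_eq, h2.pd_eq]
  field_simp
  ring

theorem potential_iff_heat {f lam : ℝ} (hf : f ≠ 0) (hl : lam ≠ 0) {D : Set (ℝ × ℝ)}
    (hD : IsOpen D) {v : ℝ × ℝ → ℝ} (hv : ContDiffOn ℝ ∞ v D) :
    IsPotentialSolution (fun _ => f) (fun _ => lam) v D ↔
      IsHeatSolution f (fun q => Real.exp (v q / (2 * f * lam))) D := by
  have hw : ContDiffOn ℝ ∞ (fun q => Real.exp (v q / (2 * f * lam))) D :=
    (hv.div_const _).exp
  rw [isPotentialSolution_iff hD hv, isHeatSolution_iff hD hw]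
  refine forall₂_congr fun p hp => ?_
  rw [coleHopf hf hl hD hv hp]
  have : Real.exp (v p / (2 * f * lam)) / (2 * f * lam) ≠ 0 := by positivity
  simp [this]

theorem IsHeatSolution.mono {f : ℝ} {w : ℝ × ℝ → ℝ} {D D' : Set (ℝ × ℝ)}
    (h : IsHeatSolution f w D) (hD : D' ⊆ D) : IsHeatSolution f w D' :=
  ⟨h.1.mono hD, fun p hp => h.2 p (hD hp)⟩

/-- The operator `∂_t - g ∂_x + f ∂_x²` is conjugate to `∂_t + f ∂_x²` by multiplication by a
function `H` that it annihilates and that satisfies `2 f H_x = g H`. -/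
theorem heat_mul {f : ℝ} {D : Set (ℝ × ℝ)} (hD : IsOpen D) {H Y g : ℝ × ℝ → ℝ}
    (hH : ContDiffOn ℝ ∞ H D) (hY : ContDiffOn ℝ ∞ Y D)
    (h1 : ∀ q ∈ D, 2 * f * pd (0, 1) H q = g q * H q)
    (h2 : ∀ q ∈ D, pd (1, 0) H q - g q * pd (0, 1) H q + f * pd (0, 1) (pd (0, 1) H) q = 0)
    {p : ℝ × ℝ} (hp : p ∈ D) :
    pd (1, 0) (fun q => H q * Y q) p - g p * pd (0, 1) (fun q => H q * Y q) p +
        f * pd (0, 1) (pd (0, 1) (fun q => H q * Y q)) p =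
      H p * (pd (1, 0) Y p + f * pd (0, 1) (pd (0, 1) Y) p) := by
  have hm : ∀ e : ℝ × ℝ, ∀ q ∈ D, HasPd e (fun q => H q * Y q)
      (pd e H q * Y q + H q * pd e Y q) q := fun e q hq =>
    (hasPd_of_contDiffOn hD hH e hq).mul (hasPd_of_contDiffOn hD hY e hq)
  have hxx := HasPd.congr hD hp
    (((hasPd_of_contDiffOn hD (contDiffOn_pd hD hH (0, 1)) (0, 1) hp).mul
      (hasPd_of_contDiffOn hD hY (0, 1) hp)).add
    ((hasPd_of_contDiffOn hD hH (0, 1) hp).mul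
      (hasPd_of_contDiffOn hD (contDiffOn_pd hD hY (0, 1)) (0, 1) hp)))
    (fun q hq => (hm (0, 1) q hq).pd_eq)
  rw [(hm _ p hp).pd_eq, (hm _ p hp).pd_eq, hxx.pd_eq]
  linear_combination Y p * h2 p hp + pd (0, 1) Y p * h1 p hp

/-- The operator `∂_t - g ∂_x + f ∂_x²` is, up to the factor `T_t`, the pullback of `∂_T + f' ∂_X²`
by `(T, X)` if `T = T(t)`, `X` is affine in `x`, `X_t = g X_x` and `f X_x² = f' T_t`. -/
theorem heat_comp {f f' : ℝ} {D D' : Set (ℝ × ℝ)} (hD : IsOpen D) (hD' : IsOpen D')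
    {T X g W : ℝ × ℝ → ℝ} (hX : ContDiffOn ℝ ∞ X D)
    (hT : ContDiffOn ℝ ∞ T D)
    (hW : ContDiffOn ℝ ∞ W D') (hψ : ∀ q ∈ D, (T q, X q) ∈ D')
    (hTx : ∀ q ∈ D, pd (0, 1) T q = 0) (hXxx : ∀ q ∈ D, pd (0, 1) (pd (0, 1) X) q = 0)
    {p : ℝ × ℝ} (hp : p ∈ D) (hg : pd (1, 0) X p = g p * pd (0, 1) X p)
    (hf : f * pd (0, 1) X p ^ 2 = f' * pd (1, 0) T p) :
    pd (1, 0) (fun q => W (T q, X q)) p - g p * pd (0, 1) (fun q => W (T q, X q)) p +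
        f * pd (0, 1) (pd (0, 1) (fun q => W (T q, X q))) p =
      pd (1, 0) T p * (pd (1, 0) W (T p, X p) + f' * pd (0, 1) (pd (0, 1) W) (T p, X p)) := by
  have hc : ∀ {h : ℝ × ℝ → ℝ}, ContDiffOn ℝ ∞ h D' → ∀ e : ℝ × ℝ, ∀ q ∈ D,
      HasPd e (fun q => h (T q, X q))
      (pd (1, 0) h (T q, X q) * pd e T q + pd (0, 1) h (T q, X q) * pd e X q) q :=
    fun hh e q hq => HasPd.comp2 (hasPd_of_contDiffOn hD' hh (1, 0) (hψ q hq)).1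
      (hasPd_of_contDiffOn hD hT e hq) (hasPd_of_contDiffOn hD hX e hq)
  have hx : ∀ q ∈ D, pd (0, 1) (fun q => W (T q, X q)) q =
      pd (0, 1) W (T q, X q) * pd (0, 1) X q := fun q hq => by
    rw [(hc hW (0, 1) q hq).pd_eq, hTx q hq]; ring
  have hxx := HasPd.congr hD hp ((hc (contDiffOn_pd hD' hW (0, 1)) (0, 1) p hp).mul
    (hasPd_of_contDiffOn hD (contDiffOn_pd hD hX (0, 1)) (0, 1) hp)) hx
  rw [hxx.pd_eq, hx p hp, (hc hW (1, 0) p hp).pd_eq, hTx p hp, hXxx p hp, hg]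
  linear_combination pd (0, 1) (pd (0, 1) W) (T p, X p) * hf

/-! ### The functions of the explicit form -/

/-- The denominator `γ t + δ`. -/
def Params.r (P : Params) (t : ℝ) : ℝ := P.γ * t + P.δ

/-- The linear function of `x` whose square is in the exponent of `F¹`. -/
def Params.N (P : Params) (x : ℝ) : ℝ := P.γ * P.κ * x - P.μ₁ * P.δ + P.μ₀ * P.γ

/-- The logarithm of `F¹ / k`, in both of the cases `γ = 0` and `γ ≠ 0`. Since `Real.log`
is `log |·|`, the factor `√|γ t + δ|` contributes `Real.log (γ t + δ) / 2`. -/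
noncomputable def Params.S (P : Params) (f : ℝ) (q : ℝ × ℝ) : ℝ :=
  if P.γ = 0 then (2 * P.κ * P.μ₁ * q.2 + P.μ₁ ^ 2 * q.1) / (4 * P.κ ^ 2 * f)
  else Real.log (P.r q.1) / 2 - P.N q.2 ^ 2 / (4 * f * P.κ ^ 2 * P.γ * P.r q.1)

theorem Params.F1_eq (P : Params) (k f : ℝ) {q : ℝ × ℝ} (hq : P.r q.1 ≠ 0) :
    P.F1 k f q.1 q.2 = k * Real.exp (P.S f q) := by
  unfold Params.F1 Params.S
  split_ifs with h
  · rfl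
  · have h1 : Real.sqrt |P.γ * q.1 + P.δ| = Real.exp (Real.log (P.r q.1) / 2) := by
      rw [← Real.log_abs, ← Real.log_sqrt (abs_nonneg _), Real.exp_log]
      · rfl
      · exact Real.sqrt_pos.2 (abs_pos.2 hq)
    rw [h1, mul_assoc, ← Real.exp_add]
    rfl

theorem Params.isOpen_r (P : Params) : IsOpen {q : ℝ × ℝ | P.r q.1 ≠ 0} := by
  have : Continuous (fun q : ℝ × ℝ => P.r q.1) := by unfold Params.r; fun_prop
  exact isOpen_ne_fun this continuous_const

theorem Params.contDiff_r (P : Params) : ContDiff ℝ ∞ (fun q : ℝ × ℝ => P.r q.1) := by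
  unfold Params.r; fun_prop

theorem Params.contDiff_N (P : Params) : ContDiff ℝ ∞ (fun q : ℝ × ℝ => P.N q.2) := by
  unfold Params.N; fun_prop

theorem Params.hasPd_r (P : Params) (e p : ℝ × ℝ) :
    HasPd e (fun q : ℝ × ℝ => P.r q.1) (P.γ * e.1) p :=
  (((hasPd_fst e p).const_mul P.γ).add (HasPd.const e P.δ p)).of_eq (by ring)

theorem Params.hasPd_N (P : Params) (e p : ℝ × ℝ) :
    HasPd e (fun q : ℝ × ℝ => P.N q.2) (P.γ * P.κ * e.2) p :=
  ((((hasPd_snd e p).const_mul (P.γ * P.κ)).sub (HasPd.const e (P.μ₁ * P.δ) p)).add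
    (HasPd.const e (P.μ₀ * P.γ) p)).of_eq (by ring)

theorem Params.contDiffOn_S (P : Params) {f : ℝ} (hf : f ≠ 0) (hκ : P.κ ≠ 0) :
    ContDiffOn ℝ ∞ (P.S f) {q | P.r q.1 ≠ 0} := by
  by_cases h : P.γ = 0
  · have : P.S f = fun q => (2 * P.κ * P.μ₁ * q.2 + P.μ₁ ^ 2 * q.1) / (4 * P.κ ^ 2 * f) := by
      funext q; simp [Params.S, h]
    rw [this]
    fun_prop
  · have : P.S f = fun q => Real.log (P.r q.1) / 2 -
        P.N q.2 ^ 2 / (4 * f * P.κ ^ 2 * P.γ * P.r q.1) := by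
      funext q; simp [Params.S, h]
    rw [this]
    refine ContDiffOn.sub ((P.contDiff_r.contDiffOn.log fun q hq => hq).div_const _) ?_
    refine ContDiffOn.div (P.contDiff_N.pow 2).contDiffOn
      (contDiff_const.mul P.contDiff_r).contDiffOn fun q hq => ?_
    have hq : P.r q.1 ≠ 0 := hq
    positivity

/-- The logarithmic derivatives of `F¹`; they are the same expressions in both of the cases `γ = 0`
and `γ ≠ 0`. -/
theorem Params.hasPd_S (P : Params) {f : ℝ} (hf : f ≠ 0) (hκ : P.κ ≠ 0) {p : ℝ × ℝ}
    (hp : P.r p.1 ≠ 0) (e : ℝ × ℝ) :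
    HasPd e (P.S f) ((P.N p.2 ^ 2 / (4 * f * P.κ ^ 2 * P.r p.1 ^ 2) + P.γ / (2 * P.r p.1)) * e.1 -
      P.N p.2 / (2 * f * P.κ * P.r p.1) * e.2) p := by
  by_cases h : P.γ = 0
  · have h0 : P.S f = fun q => (4 * P.κ ^ 2 * f)⁻¹ *
        (2 * P.κ * P.μ₁ * q.2 + P.μ₁ ^ 2 * q.1) := by
      funext q; simp [Params.S, h]; ring
    have hδ : P.δ ≠ 0 := by simpa [Params.r, h] using hp
    rw [h0]
    refine ((((hasPd_snd e p).const_mul (2 * P.κ * P.μ₁)).add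
      ((hasPd_fst e p).const_mul (P.μ₁ ^ 2))).const_mul _).of_eq ?_
    have hr : P.r p.1 = P.δ := by simp [Params.r, h]
    rw [hr, Params.N, h]
    field_simp
    ring
  · have h0 : P.S f = fun q => 2⁻¹ * Real.log (P.r q.1) -
        P.N q.2 * P.N q.2 / (4 * f * P.κ ^ 2 * P.γ * P.r q.1) := by
      funext q; simp [Params.S, h]; ring
    rw [h0]
    refine ((((P.hasPd_r e p).log hp).const_mul _).sub (((P.hasPd_N e p).mul (P.hasPd_N e p)).div
      ((P.hasPd_r e p).const_mul _) (by positivity))).of_eq ?_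
    field_simp
    ring

/-- The ratio `X_t / X_x` for the `x`-component `X` of the explicit form. -/
noncomputable def Params.g (P : Params) (q : ℝ × ℝ) : ℝ := -(P.N q.2 / (P.κ * P.r q.1))

theorem Params.hasPd_F1 (P : Params) {f : ℝ} (hf : f ≠ 0) (hκ : P.κ ≠ 0) (k : ℝ) {p : ℝ × ℝ}
    (hp : P.r p.1 ≠ 0) (e : ℝ × ℝ) :
    HasPd e (fun q => P.F1 k f q.1 q.2) (P.F1 k f p.1 p.2 *
      ((P.N p.2 ^ 2 / (4 * f * P.κ ^ 2 * P.r p.1 ^ 2) + P.γ / (2 * P.r p.1)) * e.1 -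
      P.N p.2 / (2 * f * P.κ * P.r p.1) * e.2)) p := by
  refine HasPd.congr P.isOpen_r hp ?_ (fun q hq => P.F1_eq k f hq)
  exact ((P.hasPd_S hf hκ hp e).exp.const_mul k).of_eq (by rw [P.F1_eq k f hp]; ring)

theorem Params.contDiffOn_F1 (P : Params) {f : ℝ} (hf : f ≠ 0) (hκ : P.κ ≠ 0) (k : ℝ) :
    ContDiffOn ℝ ∞ (fun q : ℝ × ℝ => P.F1 k f q.1 q.2) {q | P.r q.1 ≠ 0} :=
  (contDiffOn_const.mul (P.contDiffOn_S hf hκ).exp).congr fun _ hq => P.F1_eq k f hq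

theorem Params.F1_ne_zero (P : Params) {k f : ℝ} (hk : k ≠ 0) {q : ℝ × ℝ} (hq : P.r q.1 ≠ 0) :
    P.F1 k f q.1 q.2 ≠ 0 := by
  rw [P.F1_eq k f hq]; positivity

theorem Params.F1_x (P : Params) {f : ℝ} (hf : f ≠ 0) (hκ : P.κ ≠ 0) (k : ℝ) {p : ℝ × ℝ}
    (hp : P.r p.1 ≠ 0) :
    2 * f * pd (0, 1) (fun q => P.F1 k f q.1 q.2) p = P.g p * P.F1 k f p.1 p.2 := by
  rw [(P.hasPd_F1 hf hκ k hp (0, 1)).pd_eq, Params.g]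
  field_simp
  ring

theorem Params.F1_heat (P : Params) {f : ℝ} (hf : f ≠ 0) (hκ : P.κ ≠ 0) (k : ℝ) {p : ℝ × ℝ}
    (hp : P.r p.1 ≠ 0) :
    pd (1, 0) (fun q => P.F1 k f q.1 q.2) p - P.g p * pd (0, 1) (fun q => P.F1 k f q.1 q.2) p +
      f * pd (0, 1) (pd (0, 1) (fun q => P.F1 k f q.1 q.2)) p = 0 := by
  have h := HasPd.congr P.isOpen_r hp
    ((P.hasPd_F1 hf hκ k hp (0, 1)).mul (((P.hasPd_N (0, 1) p).div
      ((P.hasPd_r (0, 1) p).const_mul (2 * f * P.κ)) (by positivity)).const_mul (-1)))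
    (fun q hq => (P.hasPd_F1 hf hκ k hq (0, 1)).pd_eq.trans (by ring))
  rw [(P.hasPd_F1 hf hκ k hp (0, 1)).pd_eq, (P.hasPd_F1 hf hκ k hp (1, 0)).pd_eq, h.pd_eq, Params.g]
  field_simp
  ring

/-- The `t`-component of the explicit form. -/
noncomputable def Params.T (P : Params) (q : ℝ × ℝ) : ℝ := (P.α * q.1 + P.β) / P.r q.1

/-- The `x`-component of the explicit form. -/
noncomputable def Params.X (P : Params) (q : ℝ × ℝ) : ℝ :=
  (P.κ * q.2 + P.μ₁ * q.1 + P.μ₀) / P.r q.1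

theorem Params.contDiffOn_T (P : Params) : ContDiffOn ℝ ∞ P.T {q | P.r q.1 ≠ 0} :=
  ContDiffOn.div (by fun_prop) P.contDiff_r.contDiffOn fun _ hq => hq

theorem Params.contDiffOn_X (P : Params) : ContDiffOn ℝ ∞ P.X {q | P.r q.1 ≠ 0} :=
  ContDiffOn.div (by fun_prop) P.contDiff_r.contDiffOn fun _ hq => hq

theorem Params.hasPd_T (P : Params) {p : ℝ × ℝ} (hp : P.r p.1 ≠ 0) (e : ℝ × ℝ) :
    HasPd e P.T (P.Δ / P.r p.1 ^ 2 * e.1) p := by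
  refine ((((hasPd_fst e p).const_mul P.α).add (HasPd.const e P.β p)).div
    (P.hasPd_r e p) hp).of_eq ?_
  simp only [Params.r, Params.Δ] at *
  field_simp
  ring

theorem Params.hasPd_X (P : Params) (hκ : P.κ ≠ 0) {p : ℝ × ℝ} (hp : P.r p.1 ≠ 0) (e : ℝ × ℝ) :
    HasPd e P.X (P.κ / P.r p.1 * (P.g p * e.1 + e.2)) p := by
  refine (((((hasPd_snd e p).const_mul P.κ).add ((hasPd_fst e p).const_mul P.μ₁)).add
    (HasPd.const e P.μ₀ p)).div (P.hasPd_r e p) hp).of_eq ?_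
  simp only [Params.r, Params.g, Params.N] at *
  field_simp
  ring

theorem Params.X_xx (P : Params) (hκ : P.κ ≠ 0) {p : ℝ × ℝ} (hp : P.r p.1 ≠ 0) :
    pd (0, 1) (pd (0, 1) P.X) p = 0 := by
  refine (HasPd.congr P.isOpen_r hp (((HasPd.const (0, 1) P.κ p).div (P.hasPd_r (0, 1) p) hp))
    (fun q hq => (P.hasPd_X hκ hq (0, 1)).pd_eq.trans (by ring))).pd_eq.trans ?_
  simp

/-- Point transformations of the explicit form map equations. Since `exp (v' / (2 f' λ'))` pulls
back to `|F¹ (w + F⁰)|`, which is `± F¹ (w + F⁰)` near each point, the left-hand sides of the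
two linear equations are proportional at corresponding points. -/
theorem HasForm.mapsEquation {f lam f' lam' : ℝ} (hf : f ≠ 0) (hl : lam ≠ 0) (hl' : lam' ≠ 0)
    {φ : Space → Space} {Ω : Set Space} {P : Params} {k : ℝ} {F0 : ℝ × ℝ → ℝ}
    (h : HasForm f lam f' lam' φ Ω P k F0) (hφ : IsPointTransformation φ Ω) :
    MapsEquation f lam f' lam' φ Ω := by
  refine ⟨hφ, fun D D' v v' hD hD' hv hv' hΩ himg => ?_⟩
  have hκ := h.κ_ne
  have hΔ := h.Δ_ne
  have hf' : f' ≠ 0 := by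
    rw [h.eq_f]; exact mul_ne_zero (div_ne_zero (pow_ne_zero 2 hκ) hΔ) hf
  have hmem : ∀ q ∈ D, (q.1, q.2, v q) ∈ Ω := fun q hq => hΩ ⟨q, hq, rfl⟩
  have hr : ∀ q ∈ D, P.r q.1 ≠ 0 := fun q hq => h.denom_ne _ _ _ (hmem q hq)
  have hDr : D ⊆ {q | P.r q.1 ≠ 0} := hr
  have hV : ∀ q ∈ D, (P.T q, P.X q) ∈ D' ∧ Real.exp (v' (P.T q, P.X q) / (2 * f' * lam')) =
      |P.F1 k f q.1 q.2 * (Real.exp (v q / (2 * f * lam)) + F0 q)| := by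
    intro q hq
    have h1 : φ (q.1, q.2, v q) ∈ graphOver v' D' := himg ▸ ⟨_, ⟨q, hq, rfl⟩, rfl⟩
    obtain ⟨p, hp, hpq⟩ := h1
    rw [h.eq_φ _ _ _ (hmem q hq)] at hpq
    simp only [Prod.mk.injEq] at hpq
    obtain ⟨e1, e2, e3⟩ := hpq
    have hpp : p = (P.T q, P.X q) := Prod.ext e1 e2
    subst hpp
    refine ⟨hp, ?_⟩
    rw [e3, h.eq_f]
    have h2 : 2 * P.κ ^ 2 * f / P.Δ * lam' *
        Real.log |P.F1 k f q.1 q.2 * (Real.exp (v q / (2 * f * lam)) + F0 (q.1, q.2))| /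
        (2 * (P.κ ^ 2 / P.Δ * f) * lam') =
        Real.log |P.F1 k f q.1 q.2 * (Real.exp (v q / (2 * f * lam)) + F0 q)| := by
      field_simp
    rw [h2, Real.exp_log]
    exact abs_pos.2 (mul_ne_zero (P.F1_ne_zero h.k_ne (hr q hq))
      (h.log_ne _ _ _ (hmem q hq)))
  have hF0 : IsHeatSolution f F0 D := h.heat.mono fun q hq => ⟨_, hmem q hq, rfl⟩
  have hw : ContDiffOn ℝ ∞ (fun q => Real.exp (v q / (2 * f * lam))) D := (hv.div_const _).exp
  have hw' : ContDiffOn ℝ ∞ (fun q => Real.exp (v' q / (2 * f' * lam'))) D' :=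
    (hv'.div_const _).exp
  rw [potential_iff_heat hf hl hD hv, potential_iff_heat hf' hl' hD' hv',
    isHeatSolution_iff hD hw, isHeatSolution_iff hD' hw']
  -- the two left-hand sides are proportional at corresponding points
  have key : ∀ q ∈ D, (pd (1, 0) (fun q => Real.exp (v q / (2 * f * lam))) q +
      f * pd (0, 1) (pd (0, 1) (fun q => Real.exp (v q / (2 * f * lam)))) q = 0 ↔
      pd (1, 0) (fun q => Real.exp (v' q / (2 * f' * lam'))) (P.T q, P.X q) +
      f' * pd (0, 1) (pd (0, 1) (fun q => Real.exp (v' q / (2 * f' * lam')))) (P.T q, P.X q)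
        = 0) := by
    intro p hp
    have hne : P.F1 k f p.1 p.2 * (Real.exp (v p / (2 * f * lam)) + F0 p) ≠ 0 :=
      mul_ne_zero (P.F1_ne_zero h.k_ne (hr p hp)) (h.log_ne _ _ _ (hmem p hp))
    obtain ⟨s, hs, D1, hD1, hpD1, hD1D, hsD⟩ : ∃ s : ℝ, s ≠ 0 ∧ ∃ D1 : Set (ℝ × ℝ), IsOpen D1 ∧
        p ∈ D1 ∧ D1 ⊆ D ∧ ∀ q ∈ D1,
          |P.F1 k f q.1 q.2 * (Real.exp (v q / (2 * f * lam)) + F0 q)| =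
          P.F1 (s * k) f q.1 q.2 * (Real.exp (v q / (2 * f * lam)) + F0 q) := by
      have hsc : ∀ s : ℝ, ∀ q : ℝ × ℝ, P.F1 (s * k) f q.1 q.2 = s * P.F1 k f q.1 q.2 := by
        intro s q
        unfold Params.F1
        split_ifs <;> ring
      have hcont : ContinuousOn
          (fun q => P.F1 k f q.1 q.2 * (Real.exp (v q / (2 * f * lam)) + F0 q)) D :=
        ((P.contDiffOn_F1 hf hκ k).mono hDr).continuousOn.mul
          (hw.continuousOn.add hF0.1.continuousOn)
      rcases lt_or_gt_of_ne hne with hlt | hgt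
      · refine ⟨-1, by norm_num, _, hcont.isOpen_inter_preimage hD (isOpen_Iio (a := 0)),
          ⟨hp, hlt⟩, Set.inter_subset_left, fun q hq => ?_⟩
        rw [abs_of_neg hq.2, hsc]; ring
      · refine ⟨1, by norm_num, _, hcont.isOpen_inter_preimage hD (isOpen_Ioi (a := 0)),
          ⟨hp, hgt⟩, Set.inter_subset_left, fun q hq => ?_⟩
        rw [abs_of_pos hq.2, hsc]; ring
    have hD1r : D1 ⊆ {q | P.r q.1 ≠ 0} := hD1D.trans hDr
    have e1 := heat_mul (f := f) hD1 (H := fun q => P.F1 (s * k) f q.1 q.2)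
      (Y := fun q => Real.exp (v q / (2 * f * lam)) + F0 q) (g := P.g)
      ((P.contDiffOn_F1 hf hκ _).mono hD1r) ((hw.add hF0.1).mono hD1D)
      (fun q hq => P.F1_x hf hκ _ (hD1r hq)) (fun q hq => P.F1_heat hf hκ _ (hD1r hq)) hpD1
    have e2 := heat_comp (f := f) (f' := f') (g := P.g) hD1 hD' (P.contDiffOn_X.mono hD1r)
      (P.contDiffOn_T.mono hD1r) hw' (fun q hq => (hV q (hD1D hq)).1)
      (fun q hq => by rw [(P.hasPd_T (hD1r hq) (0, 1)).pd_eq]; simp)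
      (fun q hq => P.X_xx hκ (hD1r hq)) hpD1
      (by rw [(P.hasPd_X hκ (hr p hp) (1, 0)).pd_eq, (P.hasPd_X hκ (hr p hp) (0, 1)).pd_eq]; ring)
      (by
        have := hr p hp
        rw [(P.hasPd_T (hr p hp) (1, 0)).pd_eq, (P.hasPd_X hκ (hr p hp) (0, 1)).pd_eq, h.eq_f]
        simp only
        field_simp
        ring)
    have hZ : ∀ q ∈ D1, (fun q => Real.exp (v' (P.T q, P.X q) / (2 * f' * lam'))) q =
        (fun q => P.F1 (s * k) f q.1 q.2 * (Real.exp (v q / (2 * f * lam)) + F0 q)) q :=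
      fun q hq => (hV q (hD1D hq)).2.trans (hsD q hq)
    have hxx : pd (0, 1) (pd (0, 1) fun q => Real.exp (v' (P.T q, P.X q) / (2 * f' * lam'))) p =
        pd (0, 1) (pd (0, 1) fun q =>
          P.F1 (s * k) f q.1 q.2 * (Real.exp (v q / (2 * f * lam)) + F0 q)) p :=
      pd_congr hD1 hpD1 fun q hq => pd_congr hD1 hq hZ
    rw [pd_congr hD1 hpD1 hZ, pd_congr hD1 hpD1 hZ, hxx, e1] at e2
    have hadd : ∀ e : ℝ × ℝ, ∀ q ∈ D, pd e (fun q => Real.exp (v q / (2 * f * lam)) + F0 q) q =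
        pd e (fun q => Real.exp (v q / (2 * f * lam))) q + pd e F0 q := fun e q hq =>
      ((hasPd_of_contDiffOn hD hw e hq).add (hasPd_of_contDiffOn hD hF0.1 e hq)).pd_eq
    have haddx := (HasPd.congr hD hp
      ((hasPd_of_contDiffOn hD (contDiffOn_pd hD hw (0, 1)) (0, 1) hp).add
      (hasPd_of_contDiffOn hD (contDiffOn_pd hD hF0.1 (0, 1)) (0, 1) hp)) (hadd (0, 1))).pd_eq
    rw [hadd _ p hp, haddx] at e2
    have hheat := (isHeatSolution_iff hD hF0.1).1 hF0 p hp
    have hc1 : P.F1 (s * k) f p.1 p.2 ≠ 0 := P.F1_ne_zero (mul_ne_zero hs h.k_ne) (hr p hp)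
    have hc2 : pd (1, 0) P.T p ≠ 0 := by
      have := hr p hp
      rw [(P.hasPd_T (hr p hp) (1, 0)).pd_eq]
      simp only
      positivity
    rw [show ∀ a b c d : ℝ, a + b + f * (c + d) = (a + f * c) + (b + f * d) from
      fun a b c d => by ring, hheat, add_zero] at e2
    constructor
    · intro h0
      rw [h0, mul_zero] at e2
      exact (mul_eq_zero.1 e2.symm).resolve_left hc2
    · intro h0
      rw [h0, mul_zero] at e2
      exact (mul_eq_zero.1 e2).resolve_left hc1
  constructor
  · rintro h0 p hp
    have h1 : ((p.1, p.2, v' p) : Space) ∈ φ '' graphOver v D := himg ▸ ⟨p, hp, rfl⟩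
    obtain ⟨_, ⟨q, hq, rfl⟩, hqp⟩ := h1
    simp only [] at hqp
    rw [h.eq_φ _ _ _ (hmem q hq)] at hqp
    have hpp : p = (P.T q, P.X q) :=
      Prod.ext (congrArg (fun z : Space => z.1) hqp).symm
        (congrArg (fun z : Space => z.2.1) hqp).symm
    rw [hpp]
    exact (key q hq).1 (h0 q hq)
  · intro h0 q hq
    exact (key q hq).2 (h0 _ (hV q hq).1)

/-! ### Uniqueness of the constants -/

/-- Scaling the constants does not change the exponent of `F¹`, but for `γ ≠ 0` it multiplies the
square root by `√|c|`, which `k` has to compensate. -/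
theorem Params.F1_scale (P : Params) {c : ℝ} (hc : c ≠ 0) (k f t x : ℝ) :
    (P.scale c).F1 (if P.γ = 0 then k else k / Real.sqrt |c|) f t x = P.F1 k f t x := by
  by_cases h : P.γ = 0
  · simp only [Params.F1, Params.scale, h, mul_zero, if_true]
    congr 2
    by_cases hκ : P.κ = 0
    · simp [hκ]
    by_cases hf : f = 0
    · simp [hf]
    field_simp
  · have hs : Real.sqrt |c| ≠ 0 := (Real.sqrt_pos.2 (abs_pos.2 hc)).ne'
    have h1 : c * P.γ * t + c * P.δ = c * (P.γ * t + P.δ) := by ring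
    simp only [Params.F1, Params.scale, h, if_false, mul_eq_zero, hc, or_self, h1, abs_mul,
      Real.sqrt_mul (abs_nonneg c)]
    have h2 : (c * P.γ * (c * P.κ) * x - c * P.μ₁ * (c * P.δ) + c * P.μ₀ * (c * P.γ)) ^ 2 /
        (4 * f * (c * P.κ) ^ 2 * (c * P.γ) * (c * (P.γ * t + P.δ))) =
        (P.γ * P.κ * x - P.μ₁ * P.δ + P.μ₀ * P.γ) ^ 2 /
        (4 * f * P.κ ^ 2 * P.γ * (P.γ * t + P.δ)) := by
      have h3 : c ^ 4 ≠ 0 := pow_ne_zero 4 hc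
      conv_rhs => rw [← mul_div_mul_left _ _ h3]
      congr 1 <;> ring
    rw [h2]
    field_simp

theorem HasForm.scale {f lam f' lam' : ℝ} {φ : Space → Space} {Ω : Set Space} {P : Params} {k : ℝ}
    {F0 : ℝ × ℝ → ℝ} (h : HasForm f lam f' lam' φ Ω P k F0) {c : ℝ} (hc : c ≠ 0) :
    HasForm f lam f' lam' φ Ω (P.scale c) (if P.γ = 0 then k else k / Real.sqrt |c|) F0 := by
  have hs : Real.sqrt |c| ≠ 0 := (Real.sqrt_pos.2 (abs_pos.2 hc)).ne'
  have hΔ : (P.scale c).Δ = c ^ 2 * P.Δ := by simp only [Params.Δ, Params.scale]; ring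
  have hr : ∀ t, (P.scale c).γ * t + (P.scale c).δ = c * (P.γ * t + P.δ) := fun t => by
    simp only [Params.scale]; ring
  have hκ : (P.scale c).κ = c * P.κ := rfl
  have hc2 : c ^ 2 ≠ 0 := pow_ne_zero 2 hc
  refine ⟨?_, mul_ne_zero hc h.κ_ne, ?_, h.heat, ?_, h.log_ne, ?_, ?_⟩
  · rw [hΔ]; exact mul_ne_zero hc2 h.Δ_ne
  · split_ifs
    · exact h.k_ne
    · exact div_ne_zero h.k_ne hs
  · intro t x v hv
    rw [hr]; exact mul_ne_zero hc (h.denom_ne t x v hv)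
  · rw [hΔ, hκ, mul_pow, mul_div_mul_left _ _ hc2]; exact h.eq_f
  · intro t x v hv
    rw [h.eq_φ t x v hv, P.F1_scale hc, hr, hΔ, hκ, mul_pow, mul_assoc 2 (c ^ 2 * P.κ ^ 2) f,
      mul_assoc (c ^ 2), mul_left_comm 2 (c ^ 2), mul_div_mul_left _ _ hc2, ← mul_assoc 2]
    refine Prod.ext ?_ (Prod.ext ?_ rfl)
    · refine (mul_div_mul_left _ _ hc).symm.trans ?_
      simp only [Params.scale]
      congr 1
      ring
    · refine (mul_div_mul_left _ _ hc).symm.trans ?_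
      simp only [Params.scale]
      congr 1
      ring

theorem HasForm.params_unique {f lam f' lam' : ℝ} {φ : Space → Space} {Ω : Set Space}
    {P P' : Params} {k k' : ℝ} {F0 F0' : ℝ × ℝ → ℝ} (hΩ : IsOpen Ω) (hne : Ω.Nonempty)
    (h : HasForm f lam f' lam' φ Ω P k F0) (h' : HasForm f lam f' lam' φ Ω P' k' F0') :
    ∃ c : ℝ, c ≠ 0 ∧ P' = P.scale c := by
  obtain ⟨⟨t, x, v⟩, hp⟩ := hne
  -- a box around the point
  obtain ⟨ε, hε, hbox⟩ : ∃ ε : ℝ, ε ≠ 0 ∧ ∀ a ∈ ({0, 1} : Set ℝ), ∀ b ∈ ({0, 1} : Set ℝ),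
      (t + a * ε, x + b * ε, v) ∈ Ω := by
    have h0 : ∀ a b : ℝ, ∀ᶠ ε in nhdsWithin (0 : ℝ) {0}ᶜ, (t + a * ε, x + b * ε, v) ∈ Ω := by
      intro a b
      have hc : Continuous fun ε : ℝ => ((t + a * ε, x + b * ε, v) : Space) := by fun_prop
      refine nhdsWithin_le_nhds ?_
      exact (hΩ.preimage hc).mem_nhds (by simpa using hp)
    obtain ⟨ε, ⟨⟨⟨h1, h2⟩, h3⟩, h4⟩, h5⟩ := ((((h0 0 0).and (h0 0 1)).and (h0 1 0)).and
      (h0 1 1)).and self_mem_nhdsWithin |>.exists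
    refine ⟨ε, h5, ?_⟩
    rintro a (rfl | rfl) b (rfl | rfl) <;> assumption
  have hX : ∀ a ∈ ({0, 1} : Set ℝ), ∀ b ∈ ({0, 1} : Set ℝ),
      (P.κ * (x + b * ε) + P.μ₁ * (t + a * ε) + P.μ₀) * (P'.γ * (t + a * ε) + P'.δ) =
      (P'.κ * (x + b * ε) + P'.μ₁ * (t + a * ε) + P'.μ₀) * (P.γ * (t + a * ε) + P.δ) ∧
      (P.α * (t + a * ε) + P.β) * (P'.γ * (t + a * ε) + P'.δ) =
      (P'.α * (t + a * ε) + P'.β) * (P.γ * (t + a * ε) + P.δ) ∧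
      P.γ * (t + a * ε) + P.δ ≠ 0 := by
    intro a ha b hb
    have hm := hbox a ha b hb
    have e := (h.eq_φ _ _ _ hm).symm.trans (h'.eq_φ _ _ _ hm)
    have hr := h.denom_ne _ _ _ hm
    have hr' := h'.denom_ne _ _ _ hm
    simp only [Prod.mk.injEq] at e
    exact ⟨(div_eq_div_iff hr hr').1 e.2.1, (div_eq_div_iff hr hr').1 e.1, hr⟩
  have h00 := hX 0 (by simp) 0 (by simp)
  have h01 := hX 0 (by simp) 1 (by simp)
  have h10 := hX 1 (by simp) 0 (by simp)
  have h11 := hX 1 (by simp) 1 (by simp)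
  simp only [zero_mul, add_zero, one_mul] at h00 h01 h10 h11
  have hκ := h.κ_ne
  have s0 : P.κ * (P'.γ * t + P'.δ) = P'.κ * (P.γ * t + P.δ) :=
    mul_left_cancel₀ hε (by linear_combination h01.1 - h00.1)
  have s1 : P.κ * (P'.γ * (t + ε) + P'.δ) = P'.κ * (P.γ * (t + ε) + P.δ) :=
    mul_left_cancel₀ hε (by linear_combination h11.1 - h10.1)
  have hγ : P.κ * P'.γ = P'.κ * P.γ := mul_left_cancel₀ hε (by linear_combination s1 - s0)
  have hδ : P.κ * P'.δ = P'.κ * P.δ := by linear_combination s0 - t * hγ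
  -- affine functions proportional at two points are proportional
  have aff : ∀ A B A' B' : ℝ,
      (A * t + B) * (P'.γ * t + P'.δ) = (A' * t + B') * (P.γ * t + P.δ) →
      (A * (t + ε) + B) * (P'.γ * (t + ε) + P'.δ) =
        (A' * (t + ε) + B') * (P.γ * (t + ε) + P.δ) →
      P.κ * A' = P'.κ * A ∧ P.κ * B' = P'.κ * B := by
    intro A B A' B' e0 e1
    have d0 : P.κ * (A' * t + B') = P'.κ * (A * t + B) :=
      mul_right_cancel₀ h00.2.2 (by linear_combination (A * t + B) * s0 - P.κ * e0)
    have d1 : P.κ * (A' * (t + ε) + B') = P'.κ * (A * (t + ε) + B) :=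
      mul_right_cancel₀ h10.2.2 (by linear_combination (A * (t + ε) + B) * s1 - P.κ * e1)
    have d2 : P.κ * A' = P'.κ * A := mul_left_cancel₀ hε (by linear_combination d1 - d0)
    exact ⟨d2, by linear_combination d0 - t * d2⟩
  obtain ⟨hα, hβ⟩ := aff _ _ _ _ h00.2.1 h10.2.1
  obtain ⟨hμ₁, hμ₀⟩ := aff P.μ₁ (P.κ * x + P.μ₀) P'.μ₁ (P'.κ * x + P'.μ₀)
    (by linear_combination h00.1) (by linear_combination h10.1)
  have key : ∀ {A A' : ℝ}, P.κ * A' = P'.κ * A → A' = P'.κ / P.κ * A := by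
    intro A A' e
    field_simp
    linear_combination e
  refine ⟨P'.κ / P.κ, div_ne_zero h'.κ_ne hκ, ?_⟩
  ext
  · exact key hα
  · exact key hβ
  · exact key hγ
  · exact key hδ
  · exact key (by ring)
  · exact key hμ₁
  · exact key (by linear_combination hμ₀)

/-! ### Point transformations -/

section PointTransformations

variable {H K : Type*} [NormedAddCommGroup H] [NormedSpace ℝ H] [FiniteDimensional ℝ H]
  [NormedAddCommGroup K] [NormedSpace ℝ K]

theorem det_ne_zero_iff_injective (L : H →L[ℝ] H) : L.det ≠ 0 ↔ Function.Injective L := by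
  have h1 : IsUnit (L : H →ₗ[ℝ] H) ↔ IsUnit L.det := LinearMap.isUnit_iff_isUnit_det _
  rw [← isUnit_iff_ne_zero, ← h1, LinearMap.isUnit_iff_ker_eq_bot, LinearMap.ker_eq_bot]
  rfl

theorem IsPointTransformation.differentiableAt {φ : K → K} {Ω : Set K}
    (h : IsPointTransformation φ Ω) {p : K} (hp : p ∈ Ω) : DifferentiableAt ℝ φ p :=
  (h.2.1.contDiffAt (h.1.mem_nhds hp)).differentiableAt (by simp)

theorem IsPointTransformation.comp {φ ψ : K → K} {Ω Ω' : Set K}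
    (hψ : IsPointTransformation ψ Ω') (hφ : IsPointTransformation φ Ω) (hm : Set.MapsTo φ Ω Ω') :
    IsPointTransformation (fun p => ψ (φ p)) Ω := by
  refine ⟨hφ.1, hψ.2.1.comp hφ.2.1 hm, fun p hp => ?_⟩
  have h : fderiv ℝ (fun p => ψ (φ p)) p = (fderiv ℝ ψ (φ p)).comp (fderiv ℝ φ p) :=
    fderiv_comp p (hψ.differentiableAt (hm hp)) (hφ.differentiableAt hp)
  rw [h]
  have h2 : ((fderiv ℝ ψ (φ p)).comp (fderiv ℝ φ p)).det =
      (fderiv ℝ ψ (φ p)).det * (fderiv ℝ φ p).det := LinearMap.det_comp _ _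
  rw [h2]
  exact mul_ne_zero (hψ.2.2 _ (hm hp)) (hφ.2.2 p hp)

theorem IsPointTransformation.mono {φ : K → K} {Ω Ω' : Set K}
    (hφ : IsPointTransformation φ Ω) (hm : Ω' ⊆ Ω) (ho : IsOpen Ω') :
    IsPointTransformation φ Ω' :=
  ⟨ho, hφ.2.1.mono hm, fun p hp => hφ.2.2 p (hm hp)⟩

theorem isPointTransformation_of_leftInverse {φ ψ : H → H} {Ω Ω' : Set H} (hΩ : IsOpen Ω)
    (hΩ' : IsOpen Ω') (hφ : ContDiffOn ℝ ∞ φ Ω) (hψ : ContDiffOn ℝ ∞ ψ Ω')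
    (hm : Set.MapsTo φ Ω Ω') (hinv : ∀ p ∈ Ω, ψ (φ p) = p) : IsPointTransformation φ Ω := by
  refine ⟨hΩ, hφ, fun p hp => (det_ne_zero_iff_injective _).2 ?_⟩
  have d1 : DifferentiableAt ℝ φ p :=
    (hφ.contDiffAt (hΩ.mem_nhds hp)).differentiableAt (by simp)
  have d2 : DifferentiableAt ℝ ψ (φ p) :=
    (hψ.contDiffAt (hΩ'.mem_nhds (hm hp))).differentiableAt (by simp)
  have h1 : HasFDerivAt (fun p => ψ (φ p)) _ p := d2.hasFDerivAt.comp p d1.hasFDerivAt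
  have h2 : HasFDerivAt (fun p => ψ (φ p)) (ContinuousLinearMap.id ℝ H) p :=
    (hasFDerivAt_id p).congr_of_eventuallyEq (by
      filter_upwards [hΩ.mem_nhds hp] with q hq using hinv q hq)
  have h3 := h1.unique h2
  refine Function.LeftInverse.injective (g := fderiv ℝ ψ (φ p)) fun u => ?_
  exact congrArg (fun L => L u) h3

end PointTransformations

theorem isOpen_slice {E : Type} [TopologicalSpace E] {O : Set (Space × E)}
    (hO : IsOpen O) (θ : E) : IsOpen (slice O θ) :=
  hO.preimage (by fun_prop : Continuous fun q : Space => (q, θ))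

section Classes

variable {E : Type} [NormedAddCommGroup E] [NormedSpace ℝ E] [FiniteDimensional ℝ E]

/-- The differential of a transformation of the extended space that preserves the fibration by the
values of the arbitrary element is injective, hence so are its restrictions to the fibres. -/
theorem IsPointTransformation.slice {A : Space × E → Space × E} {O : Set (Space × E)}
    (h : IsPointTransformation A O) {θ θ' : E}
    (hθ : ∀ q ∈ PotBurgers.slice O θ, (A (q, θ)).2 = θ') :
    IsPointTransformation (fun q => (A (q, θ)).1) (PotBurgers.slice O θ) := by
  have ho := isOpen_slice h.1 θ
  have hi : ContDiff ℝ ∞ fun q : Space => (q, θ) := by fun_prop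
  refine ⟨ho, (h.2.1.comp hi.contDiffOn fun q hq => hq).fst, fun q hq => ?_⟩
  have hA : HasFDerivAt A (fderiv ℝ A (q, θ)) (q, θ) := (h.differentiableAt hq).hasFDerivAt
  have hc : HasFDerivAt (fun q => A (q, θ))
      ((fderiv ℝ A (q, θ)).comp (ContinuousLinearMap.inl ℝ Space E)) q :=
    hA.comp q (hasFDerivAt_prodMk_left q θ)
  have h1 := hc.fst.fderiv
  have h2 := hc.snd.unique ((hasFDerivAt_const θ' q).congr_of_eventuallyEq (by
    filter_upwards [ho.mem_nhds hq] with q hq using hθ q hq))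
  rw [det_ne_zero_iff_injective, h1, injective_iff_map_eq_zero]
  intro u hu
  have hinj := (det_ne_zero_iff_injective _).1 (h.2.2 _ hq)
  have h3 : fderiv ℝ A (q, θ) (u, 0) = 0 :=
    Prod.ext hu (congrArg (fun L => L u) h2)
  exact congrArg Prod.fst (hinj (h3.trans (map_zero _).symm))

theorem EqClass.IsExplicit.isGenEquiv {C : EqClass E} (hf : ∀ θ ∈ C.S, C.f θ ≠ 0)
    (hl : ∀ θ ∈ C.S, C.lam θ ≠ 0) {A : Space × E → Space × E} {O : Set (Space × E)}
    (hA : IsPointTransformation A O) (hO : ∀ p ∈ O, p.2 ∈ C.S) (h : C.IsExplicit A O) :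
    C.IsGenEquiv A O := by
  refine ⟨hA, hO, fun θ hθ => ?_⟩
  obtain ⟨θ', hθ', h2, P, k, F0, hP⟩ := h θ hθ
  exact ⟨θ', hθ', h2, hP.mapsEquation (hf θ hθ) (hl θ hθ) (hl θ' hθ') (hA.slice h2)⟩

/-! ### Scalings and normalization -/

/-- The scaling `(t, x, v) ↦ (t / c, x, c m v)`, which maps the potential equation with `(f, λ)` to
the one with `(c f, m λ)`. -/
noncomputable def scaling (c m : ℝ) (q : Space) : Space := (q.1 / c, q.2.1, c * m * q.2.2)

theorem scaling_inv {c m : ℝ} (hc : c ≠ 0) (hm : m ≠ 0) (q : Space) :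
    scaling c⁻¹ m⁻¹ (scaling c m q) = q := by
  refine Prod.ext ?_ (Prod.ext rfl ?_) <;> simp only [scaling] <;> field_simp

theorem scaling_inv' {c m : ℝ} (hc : c ≠ 0) (hm : m ≠ 0) (q : Space) :
    scaling c m (scaling c⁻¹ m⁻¹ q) = q := by
  simpa using scaling_inv (inv_ne_zero hc) (inv_ne_zero hm) q

theorem scaling_one (q : Space) : scaling 1 1 q = q := by simp [scaling]

theorem potential_scaling {f lam c m : ℝ} (hc : c ≠ 0) (hm : m ≠ 0)
    {D : Set (ℝ × ℝ)} (hD : IsOpen D) {v : ℝ × ℝ → ℝ} (hv : ContDiffOn ℝ ∞ v D) :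
    IsPotentialSolution (fun _ => c * f) (fun _ => m * lam) v D ↔
      IsPotentialSolution (fun _ => f) (fun _ => lam) (fun q => (c * m)⁻¹ * v (c⁻¹ * q.1, q.2))
        {q | (c⁻¹ * q.1, q.2) ∈ D} := by
  have hσ : ContDiff ℝ ∞ fun q : ℝ × ℝ => (c⁻¹ * q.1, q.2) := by fun_prop
  have hD' : IsOpen {q : ℝ × ℝ | (c⁻¹ * q.1, q.2) ∈ D} := hD.preimage hσ.continuous
  have hu : ContDiffOn ℝ ∞ (fun q : ℝ × ℝ => (c * m)⁻¹ * v (c⁻¹ * q.1, q.2))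
      {q | (c⁻¹ * q.1, q.2) ∈ D} := contDiffOn_const.mul (hv.comp hσ.contDiffOn fun q hq => hq)
  have hpd : ∀ {h : ℝ × ℝ → ℝ}, ContDiffOn ℝ ∞ h D → ∀ e : ℝ × ℝ, ∀ q : ℝ × ℝ,
      (c⁻¹ * q.1, q.2) ∈ D → HasPd e (fun q => (c * m)⁻¹ * h (c⁻¹ * q.1, q.2))
      ((c * m)⁻¹ * (pd (1, 0) h (c⁻¹ * q.1, q.2) * (c⁻¹ * e.1) +
        pd (0, 1) h (c⁻¹ * q.1, q.2) * e.2)) q := fun hh e q hq =>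
    (HasPd.comp2 (hasPd_of_contDiffOn hD hh (1, 0) hq).1 ((hasPd_fst e q).const_mul c⁻¹)
      (hasPd_snd e q)).const_mul _
  rw [isPotentialSolution_iff hD hv, isPotentialSolution_iff hD' hu]
  have key : ∀ q : ℝ × ℝ, (c⁻¹ * q.1, q.2) ∈ D →
      pd (1, 0) (fun q => (c * m)⁻¹ * v (c⁻¹ * q.1, q.2)) q + 1 / (2 * lam) *
        pd (0, 1) (fun q => (c * m)⁻¹ * v (c⁻¹ * q.1, q.2)) q ^ 2 +
        f * pd (0, 1) (pd (0, 1) fun q => (c * m)⁻¹ * v (c⁻¹ * q.1, q.2)) q =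
      (c ^ 2 * m)⁻¹ * (pd (1, 0) v (c⁻¹ * q.1, q.2) + 1 / (2 * (m * lam)) *
        pd (0, 1) v (c⁻¹ * q.1, q.2) ^ 2 +
        c * f * pd (0, 1) (pd (0, 1) v) (c⁻¹ * q.1, q.2)) := by
    intro q hq
    have hxx := HasPd.congr hD' hq (hpd (contDiffOn_pd hD hv (0, 1)) (0, 1) q hq)
      (fun q hq => (hpd hv (0, 1) q hq).pd_eq.trans (by ring))
    rw [(hpd hv _ q hq).pd_eq, (hpd hv _ q hq).pd_eq, hxx.pd_eq]
    by_cases hl : lam = 0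
    · simp [hl]; field_simp
    · field_simp
      ring
  have hcm : (c ^ 2 * m)⁻¹ ≠ 0 := by positivity
  constructor
  · intro h q hq
    rw [key q hq, h _ hq, mul_zero]
  · intro h p hp
    have hq : (c⁻¹ * (c * p.1, p.2).1, (c * p.1, p.2).2) = p := Prod.ext (by field_simp) rfl
    have h1 := h (c * p.1, p.2) (by rw [Set.mem_ofPred_eq, hq]; exact hp)
    rw [key _ (hq.symm ▸ hp), hq] at h1
    exact (mul_eq_zero.1 h1).resolve_left hcm

theorem graphOver_scaling {c m : ℝ} (hc : c ≠ 0) (hm : m ≠ 0) (D : Set (ℝ × ℝ))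
    (v : ℝ × ℝ → ℝ) :
    graphOver (fun q => (c * m)⁻¹ * v (c⁻¹ * q.1, q.2)) {q | (c⁻¹ * q.1, q.2) ∈ D} =
      scaling c⁻¹ m⁻¹ '' graphOver v D := by
  ext p
  constructor
  · rintro ⟨q, hq, rfl⟩
    refine ⟨_, ⟨_, hq, rfl⟩, ?_⟩
    refine Prod.ext ?_ (Prod.ext rfl ?_) <;> simp only [scaling] <;> field_simp
  · rintro ⟨_, ⟨q, hq, rfl⟩, rfl⟩
    have h1 : ((c⁻¹ * (c * q.1), q.2) : ℝ × ℝ) = q := Prod.ext (by field_simp) rfl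
    refine ⟨(c * q.1, q.2), ?_, ?_⟩
    · simpa only [Set.mem_ofPred_eq, h1] using hq
    · simp only [scaling, h1]
      refine Prod.ext ?_ (Prod.ext rfl ?_) <;> simp only [] <;> field_simp

theorem MapsEquation.scaling {f lam f' lam' c m : ℝ} (hc : c ≠ 0) (hm : m ≠ 0)
    {φ : Space → Space} {Ω : Set Space} (h : MapsEquation f lam f' lam' φ Ω)
    (hpt : IsPointTransformation
      (fun q => PotBurgers.scaling c m (φ (PotBurgers.scaling c⁻¹ m⁻¹ q)))
      {q | PotBurgers.scaling c⁻¹ m⁻¹ q ∈ Ω}) :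
    MapsEquation (c * f) (m * lam) (c * f') (m * lam')
      (fun q => PotBurgers.scaling c m (φ (PotBurgers.scaling c⁻¹ m⁻¹ q)))
      {q | PotBurgers.scaling c⁻¹ m⁻¹ q ∈ Ω} := by
  refine ⟨hpt, fun D D' v v' hD hD' hv hv' hΩ himg => ?_⟩
  have hσ : ContDiff ℝ ∞ fun q : ℝ × ℝ => (c⁻¹ * q.1, q.2) := by fun_prop
  rw [potential_scaling hc hm hD hv, potential_scaling hc hm hD' hv']
  refine h.2 _ _ _ _ (hD.preimage hσ.continuous) (hD'.preimage hσ.continuous)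
    (contDiffOn_const.mul (hv.comp hσ.contDiffOn fun q hq => hq))
    (contDiffOn_const.mul (hv'.comp hσ.contDiffOn fun q hq => hq)) ?_ ?_
  · rw [graphOver_scaling hc hm]
    rintro _ ⟨q, hq, rfl⟩
    exact hΩ hq
  · rw [graphOver_scaling hc hm, graphOver_scaling hc hm, ← himg, Set.image_image, Set.image_image]
    simp only [scaling_inv hc hm]

/-- A class is normalized if all its equations are obtained from any of them by scalings that depend
smoothly on the arbitrary element `η`, compatibly with a linear isomorphism `L` of the space of
arbitrary elements. The transformation `φ` from the equation with `θ` to the one with `θ' = L θ` is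
extended to `η` by conjugating it with the scaling. -/
theorem EqClass.isNormalizedGen_of_scaling {C : EqClass E} (hS : IsOpen C.S)
    (h : ∀ θ ∈ C.S, ∀ θ' ∈ C.S, ∃ (c m : E → ℝ) (L : E ≃L[ℝ] E), ContDiffOn ℝ ∞ c C.S ∧
      ContDiffOn ℝ ∞ m C.S ∧ c θ = 1 ∧ m θ = 1 ∧ L θ = θ' ∧ ∀ η ∈ C.S, c η ≠ 0 ∧ m η ≠ 0 ∧
        L η ∈ C.S ∧ C.f η = c η * C.f θ ∧ C.lam η = m η * C.lam θ ∧
        C.f (L η) = c η * C.f θ' ∧ C.lam (L η) = m η * C.lam θ') : C.IsNormalizedGen := by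
  intro θ hθ θ' hθ' φ Ω hne hφ
  obtain ⟨c, m, L, hc, hm, hcθ, hmθ, hLθ, hη⟩ := h θ hθ θ' hθ'
  -- the scalings, as a fibrewise diffeomorphism of the extended space
  have hU : IsOpen {p : Space × E | p.2 ∈ C.S} := hS.preimage continuous_snd
  have hfs : ∀ {k : E → ℝ}, ContDiffOn ℝ ∞ k C.S →
      ContDiffOn ℝ ∞ (fun p : Space × E => k p.2) {p | p.2 ∈ C.S} := fun hk =>
    hk.comp contDiffOn_snd fun p hp => hp
  have hsm : ∀ {c m : E → ℝ}, ContDiffOn ℝ ∞ c C.S → ContDiffOn ℝ ∞ m C.S → (∀ η ∈ C.S, c η ≠ 0) →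
      ContDiffOn ℝ ∞ (fun p : Space × E => (PotBurgers.scaling (c p.2) (m p.2) p.1, p.2))
        {p | p.2 ∈ C.S} := by
    intro c m hc hm hc0
    refine ContDiffOn.prodMk ?_ contDiffOn_snd
    refine ContDiffOn.prodMk (ContDiffOn.div (by fun_prop) (hfs hc) fun p hp => hc0 _ hp) ?_
    exact ContDiffOn.prodMk (by fun_prop) (((hfs hc).mul (hfs hm)).mul (by fun_prop))
  have hc0 : ∀ η ∈ C.S, c η ≠ 0 := fun η h => (hη η h).1
  have hm0 : ∀ η ∈ C.S, m η ≠ 0 := fun η h => (hη η h).2.1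
  have hs := hsm hc hm hc0
  have hsi := hsm (hc.inv hc0) (hm.inv hm0) fun η h => inv_ne_zero (hc0 η h)
  have pt := isPointTransformation_of_leftInverse hU hU hs hsi (fun p hp => hp)
    fun p hp => Prod.ext (scaling_inv (hc0 _ hp) (hm0 _ hp) _) rfl
  have pti := isPointTransformation_of_leftInverse hU hU hsi hs (fun p hp => hp)
    fun p hp => Prod.ext (scaling_inv' (hc0 _ hp) (hm0 _ hp) _) rfl
  have hΩ := hφ.1.1
  have ptφ : IsPointTransformation (fun p : Space × E => (φ p.1, p.2))
      {p | p.1 ∈ Ω ∧ p.2 ∈ C.S} := by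
    refine ⟨(hΩ.preimage continuous_fst).inter hU,
      ContDiffOn.prodMk (hφ.1.2.1.comp contDiffOn_fst fun p hp => hp.1)
        contDiffOn_snd, fun p hp => ?_⟩
    have h1 : HasFDerivAt φ (fderiv ℝ φ p.1) p.1 := (hφ.1.differentiableAt hp.1).hasFDerivAt
    have h2 : HasFDerivAt (fun p : Space × E => (φ p.1, p.2))
        (((fderiv ℝ φ p.1).comp (ContinuousLinearMap.fst ℝ Space E)).prod
          (ContinuousLinearMap.snd ℝ Space E)) p :=
      (h1.comp p hasFDerivAt_fst).prodMk hasFDerivAt_snd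
    have hinj := (det_ne_zero_iff_injective _).1 (hφ.1.2.2 p.1 hp.1)
    rw [h2.fderiv, det_ne_zero_iff_injective]
    rintro ⟨a, b⟩ ⟨a', b'⟩ hab
    obtain ⟨h3, h4⟩ := Prod.ext_iff.1 hab
    exact Prod.ext (hinj h3) h4
  have ptL : IsPointTransformation (fun p : Space × E => (p.1, L p.2)) Set.univ :=
    isPointTransformation_of_leftInverse (ψ := fun p => (p.1, L.symm p.2)) isOpen_univ isOpen_univ
      (contDiff_fst.prodMk (L.contDiff.comp contDiff_snd)).contDiffOn
      (contDiff_fst.prodMk (L.symm.contDiff.comp contDiff_snd)).contDiffOn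
      (fun _ _ => trivial) fun p _ => Prod.ext rfl (L.symm_apply_apply p.2)
  set O : Set (Space × E) :=
    {p | p.2 ∈ C.S} ∩ (fun p : Space × E => (PotBurgers.scaling (c p.2)⁻¹ (m p.2)⁻¹ p.1, p.2)) ⁻¹'
      {p | p.1 ∈ Ω ∧ p.2 ∈ C.S} with hOdef
  have hO : IsOpen O := hsi.continuousOn.isOpen_inter_preimage hU ptφ.1
  set A : Space × E → Space × E := fun p =>
    (PotBurgers.scaling (c p.2) (m p.2) (φ (PotBurgers.scaling (c p.2)⁻¹ (m p.2)⁻¹ p.1)), L p.2)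
    with hAdef
  have ptA : IsPointTransformation A O :=
    ptL.comp (pt.comp (ptφ.comp (pti.mono Set.inter_subset_left hO) fun p hp => hp.2)
      fun p hp => hp.1) fun _ _ => trivial
  have hslice : ∀ η ∈ C.S,
      slice O η = {q | PotBurgers.scaling (c η)⁻¹ (m η)⁻¹ q ∈ Ω} := by
    intro η hη
    ext q
    exact ⟨fun h => h.2.1, fun h => ⟨hη, h, hη⟩⟩
  refine ⟨A, O, ⟨ptA, fun p hp => hp.1, fun η hηS => ?_⟩, fun η hηS => ?_, ?_, ?_⟩
  · obtain ⟨h1, h2, h3, h4, h5, h6, h7⟩ := hη η hηS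
    refine ⟨L η, h3, fun _ _ => rfl, ?_⟩
    have h8 := ptA.slice (θ := η) (θ' := L η) fun _ _ => rfl
    rw [hslice η hηS] at h8 ⊢
    rw [h4, h5, h6, h7]
    exact hφ.scaling h1 h2 h8
  · obtain ⟨q, hq⟩ := hne
    refine ⟨PotBurgers.scaling (c η) (m η) q, ?_⟩
    rw [hslice η hηS, Set.mem_ofPred_eq, scaling_inv (hc0 η hηS) (hm0 η hηS)]
    exact hq
  · rw [hslice θ hθ, hcθ, hmθ]
    simp [scaling_one]
  · intro q _
    simp only [hAdef, hcθ, hmθ, inv_one, scaling_one, hLθ]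

end Classes

/-! ### The Jacobian and restrictions to graphs -/

/-- The direction of `t`. -/
abbrev et : Space := (1, 0, 0)
/-- The direction of `x`. -/
abbrev ex : Space := (0, 1, 0)
/-- The direction of `v`. -/
abbrev ev : Space := (0, 0, 1)

theorem clm_space_eq (L : Space →L[ℝ] ℝ) (u : Space) :
    L u = L et * u.1 + L ex * u.2.1 + L ev * u.2.2 := by
  have h : u = u.1 • et + u.2.1 • ex + u.2.2 • ev := by simp [et, ex, ev]
  conv_lhs => rw [h]
  rw [map_add, map_add, map_smul, map_smul, map_smul]
  simp only [smul_eq_mul]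
  ring

/-- The Jacobian of three functions of `(t, x, v)`. -/
noncomputable def jac (T X W : Space → ℝ) (p : Space) : ℝ :=
  pd et T p * (pd ex X p * pd ev W p - pd ev X p * pd ex W p) -
    pd ex T p * (pd et X p * pd ev W p - pd ev X p * pd et W p) +
    pd ev T p * (pd et X p * pd ex W p - pd ex X p * pd et W p)

theorem IsPointTransformation.jac_ne_zero {φ : Space → Space} {Ω : Set Space}
    (h : IsPointTransformation φ Ω) {p : Space} (hp : p ∈ Ω) :
    jac (fun q => (φ q).1) (fun q => (φ q).2.1) (fun q => (φ q).2.2) p ≠ 0 := by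
  intro h0
  have hd : HasFDerivAt φ (fderiv ℝ φ p) p := (h.differentiableAt hp).hasFDerivAt
  have h1 := hd.fst
  have h2 := hd.snd.fst
  have h3 := hd.snd.snd
  have hinj := (det_ne_zero_iff_injective _).1 (h.2.2 p hp)
  set M : Matrix (Fin 3) (Fin 3) ℝ :=
    !![pd et (fun q => (φ q).1) p, pd ex (fun q => (φ q).1) p, pd ev (fun q => (φ q).1) p;
      pd et (fun q => (φ q).2.1) p, pd ex (fun q => (φ q).2.1) p, pd ev (fun q => (φ q).2.1) p;
      pd et (fun q => (φ q).2.2) p, pd ex (fun q => (φ q).2.2) p, pd ev (fun q => (φ q).2.2) p]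
    with hM
  have hdet : M.det = 0 := by
    rw [Matrix.det_fin_three, ← h0, jac, hM]
    simp
    ring
  obtain ⟨u, hu, hMu⟩ := Matrix.exists_mulVec_eq_zero_iff.2 hdet
  have e : ∀ i, (M.mulVec u) i = 0 := fun i => congrFun hMu i
  have e0 := e 0
  have e1 := e 1
  have e2 := e 2
  simp only [hM, Matrix.mulVec, dotProduct, Fin.sum_univ_three] at e0 e1 e2
  simp at e0 e1 e2
  have hz : fderiv ℝ φ p (u 0, u 1, u 2) = 0 := by
    refine Prod.ext ?_ (Prod.ext ?_ ?_)
    · refine Eq.trans ?_ e0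
      have := clm_space_eq (fderiv ℝ (fun q => (φ q).1) p) (u 0, u 1, u 2)
      rw [h1.fderiv] at this
      simpa [pd, h1.fderiv] using this
    · refine Eq.trans ?_ e1
      have := clm_space_eq (fderiv ℝ (fun q => (φ q).2.1) p) (u 0, u 1, u 2)
      rw [h2.fderiv] at this
      simpa [pd, h2.fderiv] using this
    · refine Eq.trans ?_ e2
      have := clm_space_eq (fderiv ℝ (fun q => (φ q).2.2) p) (u 0, u 1, u 2)
      rw [h3.fderiv] at this
      simpa [pd, h3.fderiv] using this
  have h4 : ((u 0, u 1, u 2) : Space) = 0 := hinj (hz.trans (map_zero _).symm)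
  apply hu
  funext i
  fin_cases i
  · exact congrArg (fun z : Space => z.1) h4
  · exact congrArg (fun z : Space => z.2.1) h4
  · exact congrArg (fun z : Space => z.2.2) h4

/-- The restriction of `g` to the graph of `v`. -/
def onGraph (g : Space → ℝ) (v : ℝ × ℝ → ℝ) (q : ℝ × ℝ) : ℝ := g (q.1, q.2, v q)

section Graph

variable {Ω : Set Space} {D : Set (ℝ × ℝ)} {v : ℝ × ℝ → ℝ}

theorem onGraph_contDiffOn {g : Space → ℝ} (hg : ContDiffOn ℝ ∞ g Ω) (hv : ContDiffOn ℝ ∞ v D)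
    (hm : ∀ q ∈ D, (q.1, q.2, v q) ∈ Ω) : ContDiffOn ℝ ∞ (onGraph g v) D :=
  hg.comp (contDiffOn_fst.prodMk (contDiffOn_snd.prodMk hv)) hm

theorem hasPd_onGraph (hΩ : IsOpen Ω) (hD : IsOpen D) {g : Space → ℝ} (hg : ContDiffOn ℝ ∞ g Ω)
    (hv : ContDiffOn ℝ ∞ v D) (hm : ∀ q ∈ D, (q.1, q.2, v q) ∈ Ω) (e : ℝ × ℝ) {p : ℝ × ℝ}
    (hp : p ∈ D) :
    HasPd e (onGraph g v) (onGraph (pd et g) v p * e.1 + onGraph (pd ex g) v p * e.2 +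
      onGraph (pd ev g) v p * pd e v p) p :=
  HasPd.comp3 (h := g) (hasPd_of_contDiffOn hΩ hg et (hm p hp)).1 (hasPd_fst e p) (hasPd_snd e p)
    (hasPd_of_contDiffOn hD hv e hp)

/-- The second-order derivative of the restriction of `g` to a graph, except for the term with the
second-order derivative of the function whose graph it is. -/
noncomputable def jet2 (g : Space → ℝ) (P : Space) (e e' : ℝ × ℝ) (a a' : ℝ) : ℝ :=
  (pd et (pd et g) P * e'.1 + pd ex (pd et g) P * e'.2 + pd ev (pd et g) P * a') * e.1 +
  (pd et (pd ex g) P * e'.1 + pd ex (pd ex g) P * e'.2 + pd ev (pd ex g) P * a') * e.2 +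
  (pd et (pd ev g) P * e'.1 + pd ex (pd ev g) P * e'.2 + pd ev (pd ev g) P * a') * a

theorem pd_pd_onGraph (hΩ : IsOpen Ω) (hD : IsOpen D) {g : Space → ℝ} (hg : ContDiffOn ℝ ∞ g Ω)
    (hv : ContDiffOn ℝ ∞ v D) (hm : ∀ q ∈ D, (q.1, q.2, v q) ∈ Ω) (e e' : ℝ × ℝ) {p : ℝ × ℝ}
    (hp : p ∈ D) :
    pd e' (pd e (onGraph g v)) p = jet2 g (p.1, p.2, v p) e e' (pd e v p) (pd e' v p) +
      pd ev g (p.1, p.2, v p) * pd e' (pd e v) p := by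
  have h := HasPd.congr hD hp
    ((((hasPd_onGraph hΩ hD (contDiffOn_pd hΩ hg et) hv hm e' hp).mul (HasPd.const e' e.1 p)).add
      ((hasPd_onGraph hΩ hD (contDiffOn_pd hΩ hg ex) hv hm e' hp).mul (HasPd.const e' e.2 p))).add
      ((hasPd_onGraph hΩ hD (contDiffOn_pd hΩ hg ev) hv hm e' hp).mul
        (hasPd_of_contDiffOn hD (contDiffOn_pd hD hv e) e' hp)))
    (fun q hq => (hasPd_onGraph hΩ hD hg hv hm e hq).pd_eq)
  rw [h.pd_eq]
  simp only [jet2, onGraph]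
  ring

end Graph

theorem hasPd_comp {D D' : Set (ℝ × ℝ)} (hD : IsOpen D) (hD' : IsOpen D') {a b h : ℝ × ℝ → ℝ}
    (ha : ContDiffOn ℝ ∞ a D) (hb : ContDiffOn ℝ ∞ b D) (hh : ContDiffOn ℝ ∞ h D')
    (hm : ∀ q ∈ D, (a q, b q) ∈ D') (e : ℝ × ℝ) {p : ℝ × ℝ} (hp : p ∈ D) :
    HasPd e (fun q => h (a q, b q)) (pd (1, 0) h (a p, b p) * pd e a p +
      pd (0, 1) h (a p, b p) * pd e b p) p :=
  HasPd.comp2 (hasPd_of_contDiffOn hD' hh (1, 0) (hm p hp)).1 (hasPd_of_contDiffOn hD ha e hp)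
    (hasPd_of_contDiffOn hD hb e hp)

theorem pd_pd_comp {D D' : Set (ℝ × ℝ)} (hD : IsOpen D) (hD' : IsOpen D') {a b h : ℝ × ℝ → ℝ}
    (ha : ContDiffOn ℝ ∞ a D) (hb : ContDiffOn ℝ ∞ b D) (hh : ContDiffOn ℝ ∞ h D')
    (hm : ∀ q ∈ D, (a q, b q) ∈ D') (e e' : ℝ × ℝ) {p : ℝ × ℝ} (hp : p ∈ D) :
    pd e' (pd e (fun q => h (a q, b q))) p =
      pd (1, 0) (pd (1, 0) h) (a p, b p) * (pd e' a p * pd e a p) +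
      pd (0, 1) (pd (1, 0) h) (a p, b p) * (pd e' a p * pd e b p + pd e' b p * pd e a p) +
      pd (0, 1) (pd (0, 1) h) (a p, b p) * (pd e' b p * pd e b p) +
      pd (1, 0) h (a p, b p) * pd e' (pd e a) p + pd (0, 1) h (a p, b p) * pd e' (pd e b) p := by
  have h := HasPd.congr hD hp
    (((hasPd_comp hD hD' ha hb (contDiffOn_pd hD' hh (1, 0)) hm e' hp).mul
      (hasPd_of_contDiffOn hD (contDiffOn_pd hD ha e) e' hp)).add
    ((hasPd_comp hD hD' ha hb (contDiffOn_pd hD' hh (0, 1)) hm e' hp).mul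
      (hasPd_of_contDiffOn hD (contDiffOn_pd hD hb e) e' hp)))
    (fun q hq => (hasPd_comp hD hD' ha hb hh hm e hq).pd_eq)
  rw [h.pd_eq, pd_comm hD' hh (1, 0) (0, 1) (hm p hp)]
  ring

/-! ### Solutions with prescribed jets -/

/-- A polynomial solution of `w_t + f w_xx = 0`, written in the increments from the point `p`. The
coefficients `a`, `b`, `ρ` control its `x`-, `t`- and `tt`-derivatives at `p`, respectively. -/
def calPoly (f a b ρ : ℝ) (p q : ℝ × ℝ) : ℝ :=
  1 + a * (q.2 - p.2) + b * ((q.2 - p.2) ^ 2 - 2 * f * (q.1 - p.1)) +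
    ρ * ((q.2 - p.2) ^ 4 - 12 * f * (q.1 - p.1) * (q.2 - p.2) ^ 2 + 12 * f ^ 2 * (q.1 - p.1) ^ 2)

theorem contDiff_calPoly (f a b ρ : ℝ) (p : ℝ × ℝ) : ContDiff ℝ ∞ (calPoly f a b ρ p) := by
  unfold calPoly; fun_prop

theorem calPoly_t (f a b ρ : ℝ) (p q : ℝ × ℝ) : pd (1, 0) (calPoly f a b ρ p) q =
    -2 * f * b + ρ * (-12 * f * (q.2 - p.2) ^ 2 + 24 * f ^ 2 * (q.1 - p.1)) := by
  rw [← dt_eq_pd isOpen_univ (contDiff_calPoly f a b ρ p).contDiffOn (Set.mem_univ q)]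
  refine HasDerivAt.deriv (f := fun s => calPoly f a b ρ p (s, q.2)) ?_
  have h1 : HasDerivAt (fun s : ℝ => s - p.1) 1 q.1 := (hasDerivAt_id q.1).sub_const _
  have h := (((((h1.const_mul (2 * f)).const_sub ((q.2 - p.2) ^ 2)).const_mul b).const_add
    (1 + a * (q.2 - p.2))).add (((((h1.const_mul (12 * f)).mul_const
    ((q.2 - p.2) ^ 2)).const_sub ((q.2 - p.2) ^ 4)).add
    ((h1.pow 2).const_mul (12 * f ^ 2))).const_mul ρ))
  refine h.congr_deriv ?_
  simp; ring

theorem calPoly_x (f a b ρ : ℝ) (p q : ℝ × ℝ) : pd (0, 1) (calPoly f a b ρ p) q =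
    a + 2 * b * (q.2 - p.2) +
      ρ * (4 * (q.2 - p.2) ^ 3 - 24 * f * (q.1 - p.1) * (q.2 - p.2)) := by
  rw [← dx_eq_pd isOpen_univ (contDiff_calPoly f a b ρ p).contDiffOn (Set.mem_univ q)]
  refine HasDerivAt.deriv (f := fun s => calPoly f a b ρ p (q.1, s)) ?_
  have h1 : HasDerivAt (fun s : ℝ => s - p.2) 1 q.2 := (hasDerivAt_id q.2).sub_const _
  have h := (((h1.const_mul a).const_add 1).add
    (((h1.pow 2).sub_const (2 * f * (q.1 - p.1))).const_mul b)).add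
    ((((h1.pow 4).sub ((h1.pow 2).const_mul (12 * f * (q.1 - p.1)))).add_const
      (12 * f ^ 2 * (q.1 - p.1) ^ 2)).const_mul ρ)
  refine h.congr_deriv ?_
  simp; ring

theorem calPoly_tt (f a b ρ : ℝ) (p q : ℝ × ℝ) :
    pd (1, 0) (pd (1, 0) (calPoly f a b ρ p)) q = 24 * f ^ 2 * ρ := by
  have h1 : HasPd (1, 0) (fun q : ℝ × ℝ => -2 * f * b +
      ρ * (-12 * f * (q.2 - p.2) ^ 2 + 24 * f ^ 2 * (q.1 - p.1))) (24 * f ^ 2 * ρ) q := by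
    have hx := (hasPd_snd (1, 0) q).sub (HasPd.const (1, 0) p.2 q)
    have ht := (hasPd_fst (1, 0) q).sub (HasPd.const (1, 0) p.1 q)
    simp only [pow_two (_ - p.2)]
    refine ((HasPd.const (1, 0) (-2 * f * b) q).add ((((hx.mul hx).const_mul (-12 * f)).add
      (ht.const_mul (24 * f ^ 2))).const_mul ρ)).of_eq ?_
    ring
  rw [funext (calPoly_t f a b ρ p)]
  exact h1.pd_eq

theorem calPoly_xt (f a b ρ : ℝ) (p q : ℝ × ℝ) :
    pd (0, 1) (pd (1, 0) (calPoly f a b ρ p)) q = -24 * f * ρ * (q.2 - p.2) := by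
  have h1 : HasPd (0, 1) (fun q : ℝ × ℝ => -2 * f * b +
      ρ * (-12 * f * (q.2 - p.2) ^ 2 + 24 * f ^ 2 * (q.1 - p.1)))
      (-24 * f * ρ * (q.2 - p.2)) q := by
    have hx := (hasPd_snd (0, 1) q).sub (HasPd.const (0, 1) p.2 q)
    have ht := (hasPd_fst (0, 1) q).sub (HasPd.const (0, 1) p.1 q)
    simp only [pow_two (_ - p.2)]
    refine ((HasPd.const (0, 1) (-2 * f * b) q).add ((((hx.mul hx).const_mul (-12 * f)).add
      (ht.const_mul (24 * f ^ 2))).const_mul ρ)).of_eq ?_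
    ring
  rw [funext (calPoly_t f a b ρ p)]
  exact h1.pd_eq

theorem calPoly_xx (f a b ρ : ℝ) (p q : ℝ × ℝ) :
    pd (0, 1) (pd (0, 1) (calPoly f a b ρ p)) q =
      2 * b + ρ * (12 * (q.2 - p.2) ^ 2 - 24 * f * (q.1 - p.1)) := by
  have h1 : HasPd (0, 1) (fun q : ℝ × ℝ => a + 2 * b * (q.2 - p.2) +
      ρ * (4 * ((q.2 - p.2) * ((q.2 - p.2) * (q.2 - p.2))) -
        24 * f * ((q.1 - p.1) * (q.2 - p.2))))
      (2 * b + ρ * (12 * (q.2 - p.2) ^ 2 - 24 * f * (q.1 - p.1))) q := by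
    have hx := (hasPd_snd (0, 1) q).sub (HasPd.const (0, 1) p.2 q)
    have ht := (hasPd_fst (0, 1) q).sub (HasPd.const (0, 1) p.1 q)
    refine (((HasPd.const (0, 1) a q).add (hx.const_mul (2 * b))).add
      ((((hx.mul (hx.mul hx)).const_mul 4).sub ((ht.mul hx).const_mul (24 * f))).const_mul
        ρ)).of_eq ?_
    ring
  rw [funext (calPoly_x f a b ρ p), ← h1.pd_eq]
  congr 1
  funext q
  ring

/-- There is a solution `v = v₀ + 2 f λ log w`, `w` a caloric polynomial, with arbitrary values of
`v`, `v_x`, `v_t` and `v_tt` at a point; `v_tx` does not depend on the choice of `v_tt`. -/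
theorem exists_solution {f lam : ℝ} (hf : f ≠ 0) (hl : lam ≠ 0) (p : ℝ × ℝ) (v₀ a σ ρ : ℝ) :
    ∃ (D : Set (ℝ × ℝ)) (v : ℝ × ℝ → ℝ), IsOpen D ∧ p ∈ D ∧ ContDiffOn ℝ ∞ v D ∧
      IsPotentialSolution (fun _ => f) (fun _ => lam) v D ∧ v p = v₀ ∧ pd (0, 1) v p = a ∧
      pd (1, 0) v p = σ ∧ pd (0, 1) (pd (1, 0) v) p = -(a * σ) / (2 * f * lam) ∧
      pd (1, 0) (pd (1, 0) v) p = ρ := by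
  -- the constants are chosen to match the jet of `2 f λ log w` at `p`, where `w = 1`
  set A := a / (2 * f * lam)
  set B := -σ / (4 * f ^ 2 * lam)
  set ρ' := (ρ + σ ^ 2 / (2 * f * lam)) / (48 * f ^ 3 * lam)
  set w := calPoly f A B ρ' p with hwdef
  have hw : ContDiff ℝ ∞ w := contDiff_calPoly _ _ _ _ _
  have hD : IsOpen {q | 0 < w q} := isOpen_lt continuous_const hw.continuous
  set D := {q | 0 < w q} with hDdef
  have hwp : w p = 1 := by simp [hwdef, calPoly]
  have hp : p ∈ D := by simp [hDdef, hwp]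
  have hw0 : ∀ q ∈ D, w q ≠ 0 := fun q (hq : 0 < w q) => hq.ne'
  have hw1 := fun (e q : ℝ × ℝ) => hasPd_of_contDiffOn isOpen_univ hw.contDiffOn e (Set.mem_univ q)
  have hw2 := fun (e e' q : ℝ × ℝ) => hasPd_of_contDiffOn isOpen_univ
    (contDiffOn_pd isOpen_univ hw.contDiffOn e) e' (Set.mem_univ q)
  set v : ℝ × ℝ → ℝ := fun q => v₀ + 2 * f * lam * Real.log (w q) with hvdef
  have hv : ContDiffOn ℝ ∞ v D :=
    contDiffOn_const.add (contDiffOn_const.mul (hw.contDiffOn.log hw0))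
  have hv1 : ∀ (e : ℝ × ℝ), ∀ q ∈ D, HasPd e v (2 * f * lam * (pd e w q / w q)) q :=
    fun e q hq => ((HasPd.const e v₀ q).add
      (((hw1 e q).log (hw0 q hq)).const_mul (2 * f * lam))).of_eq (by ring)
  have hv2 : ∀ (e e' : ℝ × ℝ), ∀ q ∈ D, pd e' (pd e v) q = 2 * f * lam *
      ((pd e' (pd e w) q * w q - pd e w q * pd e' w q) / w q ^ 2) := fun e e' q hq =>
    (HasPd.congr hD hq (((hw2 e e' q).div (hw1 e' q) (hw0 q hq)).const_mul (2 * f * lam))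
      (fun q hq => (hv1 e q hq).pd_eq)).pd_eq
  refine ⟨D, v, hD, hp, hv, ?_, ?_, ?_, ?_, ?_, ?_⟩
  · rw [isPotentialSolution_iff hD hv]
    intro q hq
    have hq0 := hw0 q hq
    rw [(hv1 _ q hq).pd_eq, (hv1 _ q hq).pd_eq, hv2 _ _ q hq, hwdef, calPoly_t, calPoly_xx,
      ← hwdef]
    field_simp
    ring
  · simp [hvdef, hwp]
  · rw [(hv1 _ p hp).pd_eq, hwp, hwdef, calPoly_x]
    simp [A]; field_simp
  · rw [(hv1 _ p hp).pd_eq, hwp, hwdef, calPoly_t]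
    simp [B]; field_simp; ring
  · rw [hv2 _ _ p hp, hwp, hwdef, calPoly_xt, calPoly_t, calPoly_x]
    simp [A, B]; field_simp; ring
  · rw [hv2 _ _ p hp, hwp, hwdef, calPoly_tt, calPoly_t]
    simp [B, ρ']; field_simp; ring

/-! ### Transformed solutions -/

/-- The inverse function theorem in the plane, with smoothness of the inverse on a neighbourhood. -/
theorem exists_local_inverse {D : Set (ℝ × ℝ)} (hD : IsOpen D) {a b : ℝ × ℝ → ℝ}
    (ha : ContDiffOn ℝ ∞ a D) (hb : ContDiffOn ℝ ∞ b D) {p : ℝ × ℝ} (hp : p ∈ D)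
    (hJ : pd (1, 0) a p * pd (0, 1) b p - pd (0, 1) a p * pd (1, 0) b p ≠ 0) :
    ∃ (D₁ D' : Set (ℝ × ℝ)) (i : ℝ × ℝ → ℝ × ℝ), IsOpen D₁ ∧ p ∈ D₁ ∧ D₁ ⊆ D ∧ IsOpen D' ∧
      ContDiffOn ℝ ∞ i D' ∧ (∀ q ∈ D₁, (a q, b q) ∈ D' ∧ i (a q, b q) = q) ∧
      ∀ q ∈ D', i q ∈ D₁ ∧ (a (i q), b (i q)) = q := by
  set ψ : ℝ × ℝ → ℝ × ℝ := fun q => (a q, b q) with hψdef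
  have hψ : ContDiffOn ℝ ∞ ψ D := ha.prodMk hb
  have hJc : ContinuousOn
      (fun q => pd (1, 0) a q * pd (0, 1) b q - pd (0, 1) a q * pd (1, 0) b q) D :=
    ((contDiffOn_pd hD ha _).continuousOn.mul (contDiffOn_pd hD hb _).continuousOn).sub
      ((contDiffOn_pd hD ha _).continuousOn.mul (contDiffOn_pd hD hb _).continuousOn)
  have hD₀ := hJc.isOpen_inter_preimage hD (isOpen_compl_singleton (x := (0 : ℝ)))
  set D₀ := D ∩ (fun q => pd (1, 0) a q * pd (0, 1) b q - pd (0, 1) a q * pd (1, 0) b q) ⁻¹' {0}ᶜ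
  have hp₀ : p ∈ D₀ := ⟨hp, hJ⟩
  -- the differential is invertible
  have hdiff : ∀ q ∈ D₀, ∃ e : (ℝ × ℝ) ≃L[ℝ] (ℝ × ℝ),
      HasFDerivAt ψ (e : (ℝ × ℝ) →L[ℝ] ℝ × ℝ) q := by
    intro q hq
    have h1 : HasFDerivAt ψ ((fderiv ℝ a q).prod (fderiv ℝ b q)) q :=
      (hasPd_of_contDiffOn hD ha (1, 0) hq.1).1.hasFDerivAt.prodMk
        (hasPd_of_contDiffOn hD hb (1, 0) hq.1).1.hasFDerivAt
    have hinj : Function.Injective ((fderiv ℝ a q).prod (fderiv ℝ b q)) := by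
      rw [injective_iff_map_eq_zero]
      rintro ⟨s, y⟩ hsy
      have hlin : ∀ L : (ℝ × ℝ) →L[ℝ] ℝ, L (s, y) = L (1, 0) * s + L (0, 1) * y := by
        intro L
        have h : ((s, y) : ℝ × ℝ) = s • ((1, 0) : ℝ × ℝ) + y • ((0, 1) : ℝ × ℝ) := by simp
        rw [h, map_add, map_smul, map_smul]
        simp [mul_comm]
      have e1 : pd (1, 0) a q * s + pd (0, 1) a q * y = 0 :=
        (hlin _).symm.trans (congrArg Prod.fst hsy)
      have e2 : pd (1, 0) b q * s + pd (0, 1) b q * y = 0 :=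
        (hlin _).symm.trans (congrArg Prod.snd hsy)
      have hJq : pd (1, 0) a q * pd (0, 1) b q - pd (0, 1) a q * pd (1, 0) b q ≠ 0 := hq.2
      refine Prod.ext (mul_left_cancel₀ hJq ?_) (mul_left_cancel₀ hJq ?_)
      · simp only [Prod.fst_zero, mul_zero]
        linear_combination pd (0, 1) b q * e1 - pd (0, 1) a q * e2
      · simp only [Prod.snd_zero, mul_zero]
        linear_combination pd (1, 0) a q * e2 - pd (1, 0) b q * e1
    refine ⟨(LinearEquiv.ofInjectiveEndo _ hinj).toContinuousLinearEquiv, ?_⟩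
    convert h1 using 1
    ext <;> rfl
  obtain ⟨e, he⟩ := hdiff p hp₀
  have hψp : ContDiffAt ℝ ∞ ψ p := hψ.contDiffAt (hD.mem_nhds hp)
  set Φ := hψp.toOpenPartialHomeomorph ψ he (by simp) with hΦ
  have hpΦ : p ∈ Φ.source := hψp.mem_toOpenPartialHomeomorph_source he (by simp)
  have hD₁ : IsOpen (D₀ ∩ Φ.source) := hD₀.inter Φ.open_source
  refine ⟨D₀ ∩ Φ.source, Φ '' (D₀ ∩ Φ.source), Φ.symm, hD₁, ⟨hp₀, hpΦ⟩, fun q hq => hq.1.1,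
    Φ.isOpen_image_of_subset_source hD₁ Set.inter_subset_right, ?_, fun q hq => ⟨⟨q, hq, rfl⟩,
      Φ.left_inv hq.2⟩, ?_⟩
  · rintro _ ⟨q, hq, rfl⟩
    obtain ⟨e', he'⟩ := hdiff q hq.1
    have h1 : Φ.symm (Φ q) = q := Φ.left_inv hq.2
    refine (Φ.contDiffAt_symm (Φ.map_source hq.2) (f₀' := e') ?_ ?_).contDiffWithinAt
    · rw [h1]; exact he'
    · rw [h1]; exact hψ.contDiffAt (hD.mem_nhds hq.1.1)
  · rintro _ ⟨q, hq, rfl⟩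
    have h1 : Φ.symm (Φ q) = q := Φ.left_inv hq.2
    rw [h1]
    exact ⟨hq, rfl⟩

/-- The transformation `(T, X, W)` locally maps solutions of the potential equation with `(f, λ)`,
wherever the image of the graph is transversal to the direction of `W`, to solutions of the linear
equation with `f'`. -/
structure SendsSolutions (f lam f' : ℝ) (Ω : Set Space) (T X W : Space → ℝ) : Prop where
  isOpen : IsOpen Ω
  T_smooth : ContDiffOn ℝ ∞ T Ω
  X_smooth : ContDiffOn ℝ ∞ X Ω
  W_smooth : ContDiffOn ℝ ∞ W Ω
  jac_ne : ∀ p ∈ Ω, jac T X W p ≠ 0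
  push : ∀ (D : Set (ℝ × ℝ)) (v : ℝ × ℝ → ℝ), IsOpen D →
    IsPotentialSolution (fun _ => f) (fun _ => lam) v D → (∀ q ∈ D, (q.1, q.2, v q) ∈ Ω) →
    ∀ p ∈ D, pd (1, 0) (onGraph T v) p * pd (0, 1) (onGraph X v) p -
        pd (0, 1) (onGraph T v) p * pd (1, 0) (onGraph X v) p ≠ 0 →
      ∃ (D₁ D' : Set (ℝ × ℝ)) (w : ℝ × ℝ → ℝ), IsOpen D₁ ∧ p ∈ D₁ ∧ D₁ ⊆ D ∧ IsOpen D' ∧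
        ContDiffOn ℝ ∞ w D' ∧ (∀ q ∈ D', pd (1, 0) w q + f' * pd (0, 1) (pd (0, 1) w) q = 0) ∧
        ∀ q ∈ D₁, (onGraph T v q, onGraph X v q) ∈ D' ∧
          w (onGraph T v q, onGraph X v q) = onGraph W v q

theorem MapsEquation.sendsSolutions {f lam f' lam' : ℝ} (hf' : f' ≠ 0) (hl' : lam' ≠ 0)
    {φ : Space → Space} {Ω : Set Space} (h : MapsEquation f lam f' lam' φ Ω) :
    SendsSolutions f lam f' Ω (fun q => (φ q).1) (fun q => (φ q).2.1)
      (fun q => Real.exp ((φ q).2.2 / (2 * f' * lam'))) := by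
  have hT : ContDiffOn ℝ ∞ (fun q => (φ q).1) Ω := h.1.2.1.fst
  have hX : ContDiffOn ℝ ∞ (fun q => (φ q).2.1) Ω := h.1.2.1.snd.fst
  have hV : ContDiffOn ℝ ∞ (fun q => (φ q).2.2) Ω := h.1.2.1.snd.snd
  refine ⟨h.1.1, hT, hX, (hV.div_const _).exp, fun p hp => ?_, fun D v hD hv hm p hp hJ => ?_⟩
  · have hW : ∀ e : Space, pd e (fun q => Real.exp ((φ q).2.2 / (2 * f' * lam'))) p =
        Real.exp ((φ p).2.2 / (2 * f' * lam')) / (2 * f' * lam') *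
          pd e (fun q => (φ q).2.2) p := by
      intro e
      have h1 := ((hasPd_of_contDiffOn h.1.1 hV e hp).const_mul (2 * f' * lam')⁻¹).exp
      simp only [div_eq_inv_mul]
      rw [h1.pd_eq]
      ring
    have h0 := h.1.jac_ne_zero hp
    have hc : Real.exp ((φ p).2.2 / (2 * f' * lam')) / (2 * f' * lam') ≠ 0 := by positivity
    intro hj
    refine h0 (mul_left_cancel₀ hc ?_)
    rw [jac, hW, hW, hW] at hj
    rw [jac]
    linear_combination hj
  · obtain ⟨D₁, D', i, hD₁, hp₁, hsub, hD', hi, hi1, hi2⟩ := exists_local_inverse hD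
      (onGraph_contDiffOn hT hv.1 hm) (onGraph_contDiffOn hX hv.1 hm) hp hJ
    have hV1 := (onGraph_contDiffOn hV hv.1 hm).mono hsub
    set v' : ℝ × ℝ → ℝ := fun q => onGraph (fun q => (φ q).2.2) v (i q)
    have hv' : ContDiffOn ℝ ∞ v' D' := hV1.comp hi fun q hq => (hi2 q hq).1
    have hsol := (h.2 D₁ D' v v' hD₁ hD' (hv.1.mono hsub) hv'
      (by rintro _ ⟨q, hq, rfl⟩; exact hm q (hsub hq)) (by
        ext P
        constructor
        · rintro ⟨_, ⟨q, hq, rfl⟩, rfl⟩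
          refine ⟨_, (hi1 q hq).1, ?_⟩
          simp only [v', (hi1 q hq).2]
          rfl
        · rintro ⟨q, hq, rfl⟩
          refine ⟨_, ⟨i q, (hi2 q hq).1, rfl⟩, ?_⟩
          have h1 := (hi2 q hq).2
          have e1 := congrArg Prod.fst h1
          have e2 := congrArg Prod.snd h1
          exact Prod.ext e1 (Prod.ext e2 rfl))).1
      ⟨hv.1.mono hsub, fun q hq => hv.2 q (hsub hq)⟩
    rw [potential_iff_heat hf' hl' hD' hv'] at hsol
    refine ⟨D₁, D', _, hD₁, hp₁, hsub, hD', hsol.1, (isHeatSolution_iff hD' hsol.1).1 hsol,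
      fun q hq => ⟨(hi1 q hq).1, ?_⟩⟩
    simp only [v', (hi1 q hq).2]
    rfl

/-! ### Determining equations -/

theorem IsPotentialSolution.mono {f : ℝ × ℝ → ℝ} {lam : ℝ → ℝ} {v : ℝ × ℝ → ℝ}
    {D D' : Set (ℝ × ℝ)} (h : IsPotentialSolution f lam v D) (hD : D' ⊆ D) :
    IsPotentialSolution f lam v D' :=
  ⟨h.1.mono hD, fun p hp => h.2 p (hD hp)⟩

/-- The relation between the second-order jet of a solution (with `v_x = a`, `v_t = σ`, `v_tt = ρ`)
at a point and the jet of the transformed solution, whose derivatives are `wt`, `wx`, `wtt`,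
`wtx` and `wxx`. -/
theorem SendsSolutions.exists_transformed_jet {f lam f' : ℝ} (hf : f ≠ 0) (hl : lam ≠ 0)
    {Ω : Set Space} {T X W : Space → ℝ} (h : SendsSolutions f lam f' Ω T X W)
    {P : Space} (hP : P ∈ Ω) (a σ ρ : ℝ)
    (hJ : (pd et T P + pd ev T P * σ) * (pd ex X P + pd ev X P * a) -
      (pd ex T P + pd ev T P * a) * (pd et X P + pd ev X P * σ) ≠ 0) :
    ∃ wt wx wtt wtx wxx : ℝ, wt + f' * wxx = 0 ∧
      pd et W P + pd ev W P * σ =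
        wt * (pd et T P + pd ev T P * σ) + wx * (pd et X P + pd ev X P * σ) ∧
      pd ex W P + pd ev W P * a =
        wt * (pd ex T P + pd ev T P * a) + wx * (pd ex X P + pd ev X P * a) ∧
      jet2 W P (1, 0) (1, 0) σ σ + pd ev W P * ρ =
        wtt * (pd et T P + pd ev T P * σ) ^ 2 +
        2 * wtx * ((pd et T P + pd ev T P * σ) * (pd et X P + pd ev X P * σ)) +
        wxx * (pd et X P + pd ev X P * σ) ^ 2 +
        wt * (jet2 T P (1, 0) (1, 0) σ σ + pd ev T P * ρ) +
        wx * (jet2 X P (1, 0) (1, 0) σ σ + pd ev X P * ρ) ∧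
      jet2 W P (1, 0) (0, 1) σ a + pd ev W P * (-(a * σ) / (2 * f * lam)) =
        wtt * ((pd ex T P + pd ev T P * a) * (pd et T P + pd ev T P * σ)) +
        wtx * ((pd ex T P + pd ev T P * a) * (pd et X P + pd ev X P * σ) +
          (pd ex X P + pd ev X P * a) * (pd et T P + pd ev T P * σ)) +
        wxx * ((pd ex X P + pd ev X P * a) * (pd et X P + pd ev X P * σ)) +
        wt * (jet2 T P (1, 0) (0, 1) σ a + pd ev T P * (-(a * σ) / (2 * f * lam))) +
        wx * (jet2 X P (1, 0) (0, 1) σ a + pd ev X P * (-(a * σ) / (2 * f * lam))) ∧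
      jet2 W P (0, 1) (0, 1) a a + pd ev W P * (-(σ + a ^ 2 / (2 * lam)) / f) =
        wtt * (pd ex T P + pd ev T P * a) ^ 2 +
        2 * wtx * ((pd ex T P + pd ev T P * a) * (pd ex X P + pd ev X P * a)) +
        wxx * (pd ex X P + pd ev X P * a) ^ 2 +
        wt * (jet2 T P (0, 1) (0, 1) a a + pd ev T P * (-(σ + a ^ 2 / (2 * lam)) / f)) +
        wx * (jet2 X P (0, 1) (0, 1) a a + pd ev X P * (-(σ + a ^ 2 / (2 * lam)) / f)) := by
  obtain ⟨D₀, v, hD₀, hp₀, hv₀, hsol₀, hv1, hv2, hv3, hv4, hv5⟩ :=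
    exists_solution hf hl (P.1, P.2.1) P.2.2 a σ ρ
  have hcont : ContinuousOn (fun q : ℝ × ℝ => ((q.1, q.2, v q) : Space)) D₀ :=
    continuousOn_fst.prodMk (continuousOn_snd.prodMk hv₀.continuousOn)
  have hD := hcont.isOpen_inter_preimage hD₀ h.isOpen
  set D := D₀ ∩ (fun q : ℝ × ℝ => ((q.1, q.2, v q) : Space)) ⁻¹' Ω
  set p : ℝ × ℝ := (P.1, P.2.1) with hpdef
  have hPp : ((p.1, p.2, v p) : Space) = P := by rw [hv1]
  have hp : p ∈ D := ⟨hp₀, by rw [Set.mem_preimage, hPp]; exact hP⟩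
  have hv : ContDiffOn ℝ ∞ v D := hv₀.mono Set.inter_subset_left
  have hsol := hsol₀.mono (D' := D) Set.inter_subset_left
  have hm : ∀ q ∈ D, (q.1, q.2, v q) ∈ Ω := fun q hq => hq.2
  have hv6 : pd (0, 1) (pd (0, 1) v) p = -(σ + a ^ 2 / (2 * lam)) / f := by
    have := (isPotentialSolution_iff hD hv).1 hsol p hp
    rw [hv2, hv3] at this
    field_simp
    field_simp at this
    linear_combination this
  have hgt : ∀ {g : Space → ℝ}, ContDiffOn ℝ ∞ g Ω →
      pd (1, 0) (onGraph g v) p = pd et g P + pd ev g P * σ := fun hg => by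
    rw [(hasPd_onGraph h.isOpen hD hg hv hm (1, 0) hp).pd_eq, hv3]
    simp only [onGraph, hPp]; ring
  have hgx : ∀ {g : Space → ℝ}, ContDiffOn ℝ ∞ g Ω →
      pd (0, 1) (onGraph g v) p = pd ex g P + pd ev g P * a := fun hg => by
    rw [(hasPd_onGraph h.isOpen hD hg hv hm (0, 1) hp).pd_eq, hv2]
    simp only [onGraph, hPp]; ring
  have hg2 : ∀ {g : Space → ℝ}, ContDiffOn ℝ ∞ g Ω → ∀ e e' : ℝ × ℝ,
      pd e' (pd e (onGraph g v)) p = jet2 g P e e' (pd e v p) (pd e' v p) +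
        pd ev g P * pd e' (pd e v) p := fun hg e e' => by
    rw [pd_pd_onGraph h.isOpen hD hg hv hm e e' hp, hPp]
  have hT := h.T_smooth
  have hX := h.X_smooth
  have hW := h.W_smooth
  obtain ⟨D₁, D', w, hD₁, hp₁, hsub, hD', hw, heat, hcomp⟩ := h.push D v hD hsol hm p hp
    (by rw [hgt hT, hgx hX, hgx hT, hgt hX]; exact hJ)
  have hT' := (onGraph_contDiffOn hT hv hm).mono hsub
  have hX' := (onGraph_contDiffOn hX hv hm).mono hsub
  have hm' : ∀ q ∈ D₁, (onGraph T v q, onGraph X v q) ∈ D' := fun q hq => (hcomp q hq).1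
  have c1 : ∀ e : ℝ × ℝ, ∀ q ∈ D₁, pd e (onGraph W v) q =
      pd e (fun q => w (onGraph T v q, onGraph X v q)) q := fun e q hq =>
    pd_congr hD₁ hq fun q hq => (hcomp q hq).2.symm
  have c2 : ∀ e e' : ℝ × ℝ, pd e' (pd e (onGraph W v)) p =
      pd e' (pd e (fun q => w (onGraph T v q, onGraph X v q))) p := fun e e' =>
    pd_congr hD₁ hp₁ (c1 e)
  have f1 : ∀ e : ℝ × ℝ, _ := fun e => (c1 e p hp₁).trans
    (hasPd_comp hD₁ hD' hT' hX' hw hm' e hp₁).pd_eq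
  have f2 : ∀ e e' : ℝ × ℝ, _ := fun e e' => (c2 e e').trans
    (pd_pd_comp hD₁ hD' hT' hX' hw hm' e e' hp₁)
  have ft := f1 (1, 0)
  have fx := f1 (0, 1)
  have ftt := f2 (1, 0) (1, 0)
  have ftx := f2 (1, 0) (0, 1)
  have fxx := f2 (0, 1) (0, 1)
  simp only [hgt hT, hgt hX, hgt hW, hgx hT, hgx hX, hgx hW, hg2 hT, hg2 hX, hg2 hW, hv2, hv3, hv4,
    hv5, hv6] at ft fx ftt ftx fxx
  refine ⟨_, _, pd (1, 0) (pd (1, 0) w) (onGraph T v p, onGraph X v p),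
    pd (0, 1) (pd (1, 0) w) (onGraph T v p, onGraph X v p), _,
    heat _ (hm' p hp₁), ft, fx, ?_, ?_, ?_⟩
  · linear_combination ftt
  · linear_combination ftx
  · linear_combination fxx

section

variable {f lam f' : ℝ} {Ω : Set Space} {T X W : Space → ℝ}

/-- Two solutions with the same `v_x` and `v_t` that differ in `v_tt` are mapped to solutions with
the same first-order derivatives and, by the target equation, the same `wxx`. If the total
derivative `T_x + T_v a` did not vanish, then `wtx` and `wtt` would be the same too. -/
theorem SendsSolutions.T_x_add_T_v_mul_eq_zero (hf : f ≠ 0) (hl : lam ≠ 0) (hf' : f' ≠ 0)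
    (h : SendsSolutions f lam f' Ω T X W) {P : Space} (hP : P ∈ Ω) (a σ : ℝ)
    (hJ : (pd et T P + pd ev T P * σ) * (pd ex X P + pd ev X P * a) -
      (pd ex T P + pd ev T P * a) * (pd et X P + pd ev X P * σ) ≠ 0) :
    pd ex T P + pd ev T P * a = 0 := by
  obtain ⟨wt, wx, wtt, wtx, wxx, h0, h1, h2, h3, h4, h5⟩ :=
    h.exists_transformed_jet hf hl hP a σ 0 hJ
  obtain ⟨wt', wx', wtt', wtx', wxx', h0', h1', h2', h3', h4', h5'⟩ :=
    h.exists_transformed_jet hf hl hP a σ 1 hJ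
  have hjac := h.jac_ne P hP
  generalize hTt : pd et T P + pd ev T P * σ = Tt at *
  generalize hTx : pd ex T P + pd ev T P * a = Tx at *
  generalize hXt : pd et X P + pd ev X P * σ = Xt at *
  generalize hXx : pd ex X P + pd ev X P * a = Xx at *
  by_contra hTx0
  -- the first-order derivatives coincide
  have ewt : wt' = wt := mul_left_cancel₀ hJ (by
    linear_combination Xx * (h1 - h1') - Xt * (h2 - h2'))
  have ewx : wx' = wx := mul_left_cancel₀ hJ (by
    linear_combination Tt * (h2 - h2') - Tx * (h1 - h1'))
  subst ewt ewx
  have ewxx : wxx' = wxx := mul_left_cancel₀ hf' (by linear_combination h0' - h0)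
  subst ewxx
  have d1 : (wtt' - wtt) * Tx + 2 * (wtx' - wtx) * Xx = 0 :=
    mul_left_cancel₀ hTx0 (by linear_combination h5 - h5')
  have d2 : wtx' - wtx = 0 := mul_left_cancel₀ hJ (by
    linear_combination h4' - h4 + Tt * d1)
  have d3 : wtt' - wtt = 0 := mul_left_cancel₀ hTx0 (by linear_combination d1 - 2 * Xx * d2)
  have d4 : pd ev W P - wt' * pd ev T P - wx' * pd ev X P = 0 := by
    linear_combination h3' - h3 + Tt ^ 2 * d3 + 2 * Tt * Xt * d2
  -- the differentials of `T`, `X`, `W` are linearly dependent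
  refine hjac ?_
  rw [jac]
  subst hTt hTx hXt hXx
  linear_combination
    (pd et T P * pd ex X P - pd ex T P * pd et X P) * d4 +
    (-pd et T P * pd ev X P + pd ev T P * pd et X P) * (h2 - a * d4) +
    (pd ex T P * pd ev X P - pd ev T P * pd ex X P) * (h1 - σ * d4)

theorem SendsSolutions.T_eq_zero (hf : f ≠ 0) (hl : lam ≠ 0) (hf' : f' ≠ 0)
    (h : SendsSolutions f lam f' Ω T X W) {P : Space} (hP : P ∈ Ω) :
    pd ex T P = 0 ∧ pd ev T P = 0 := by
  have key := h.T_x_add_T_v_mul_eq_zero hf hl hf' hP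
  have hjac := h.jac_ne P hP
  obtain ⟨a₁, σ₁, a₂, σ₂, hne, hJ₁, hJ₂⟩ : ∃ a₁ σ₁ a₂ σ₂ : ℝ, a₁ ≠ a₂ ∧
      (pd et T P + pd ev T P * σ₁) * (pd ex X P + pd ev X P * a₁) -
        (pd ex T P + pd ev T P * a₁) * (pd et X P + pd ev X P * σ₁) ≠ 0 ∧
      (pd et T P + pd ev T P * σ₂) * (pd ex X P + pd ev X P * a₂) -
        (pd ex T P + pd ev T P * a₂) * (pd et X P + pd ev X P * σ₂) ≠ 0 := by
    -- the Jacobian is affine in the slopes, with the `2 × 2` minors as coefficients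
    have hJ : ∀ a σ : ℝ, (pd et T P + pd ev T P * σ) * (pd ex X P + pd ev X P * a) -
        (pd ex T P + pd ev T P * a) * (pd et X P + pd ev X P * σ) =
        (pd et T P * pd ex X P - pd ex T P * pd et X P) +
        (pd et T P * pd ev X P - pd ev T P * pd et X P) * a +
        (pd ev T P * pd ex X P - pd ex T P * pd ev X P) * σ := fun a σ => by ring
    simp only [hJ]
    have hj : jac T X W P = (pd et T P * pd ex X P - pd ex T P * pd et X P) * pd ev W P -
        (pd et T P * pd ev X P - pd ev T P * pd et X P) * pd ex W P +
        -(pd ev T P * pd ex X P - pd ex T P * pd ev X P) * pd et W P := by rw [jac]; ring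
    rw [hj] at hjac
    generalize pd et T P * pd ex X P - pd ex T P * pd et X P = m₁ at *
    generalize pd et T P * pd ev X P - pd ev T P * pd et X P = m₂ at *
    generalize pd ev T P * pd ex X P - pd ex T P * pd ev X P = m₃ at *
    by_cases h3 : m₃ = 0
    · by_cases h2 : m₂ = 0
      · refine ⟨0, 0, 1, 0, zero_ne_one, ?_, ?_⟩ <;>
        · simp only [h2, h3, zero_mul, add_zero]
          rintro rfl
          simp [h2, h3] at hjac
      · refine ⟨(1 - m₁) / m₂, 0, (2 - m₁) / m₂, 0, ?_, ?_, ?_⟩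
        · intro he
          rw [div_left_inj' h2] at he
          linarith
        · rw [mul_div_cancel₀ _ h2]; simp
        · rw [mul_div_cancel₀ _ h2]; simp
    · refine ⟨0, (1 - m₁) / m₃, 1, (1 - m₁ - m₂) / m₃, zero_ne_one, ?_, ?_⟩
      · rw [mul_div_cancel₀ _ h3]; simp
      · rw [mul_div_cancel₀ _ h3]; simp
  have e₁ := key a₁ σ₁ hJ₁
  have e₂ := key a₂ σ₂ hJ₂
  have hv : pd ev T P = 0 := mul_left_cancel₀ (sub_ne_zero.2 hne) (by linear_combination e₁ - e₂)
  exact ⟨by simpa [hv] using e₁, hv⟩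

theorem pd_eq_zero {E : Type*} [NormedAddCommGroup E] [NormedSpace ℝ E] {U : Set E}
    (hU : IsOpen U) {g : E → ℝ} (hg : ∀ p ∈ U, g p = 0) (e : E) {p : E} (hp : p ∈ U) :
    pd e g p = 0 :=
  (HasPd.congr hU hp (HasPd.const e 0 p) hg).pd_eq

theorem SendsSolutions.T_t_and_minor_ne_zero (hf : f ≠ 0) (hl : lam ≠ 0) (hf' : f' ≠ 0)
    (h : SendsSolutions f lam f' Ω T X W) {P : Space} (hP : P ∈ Ω) :
    pd et T P ≠ 0 ∧ pd ex X P * pd ev W P - pd ev X P * pd ex W P ≠ 0 := by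
  obtain ⟨h1, h2⟩ := h.T_eq_zero hf hl hf' hP
  have h3 := h.jac_ne P hP
  rw [jac, h1, h2, zero_mul, zero_mul, sub_zero, add_zero] at h3
  exact ne_zero_and_ne_zero_of_mul h3

/-- The target equation for a transformed solution with `v_x = a` and `v_t = σ`, in terms of the
transformation. -/
theorem SendsSolutions.determining_equation (hf : f ≠ 0) (hl : lam ≠ 0) (hf' : f' ≠ 0)
    (h : SendsSolutions f lam f' Ω T X W) {P : Space} (hP : P ∈ Ω) (a σ : ℝ)
    (hX : pd ex X P + pd ev X P * a ≠ 0) :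
    (pd ex X P + pd ev X P * a) ^ 2 *
        ((pd et W P + pd ev W P * σ) * (pd ex X P + pd ev X P * a) -
          (pd et X P + pd ev X P * σ) * (pd ex W P + pd ev W P * a)) +
      f' * pd et T P *
        ((jet2 W P (0, 1) (0, 1) a a + pd ev W P * (-(σ + a ^ 2 / (2 * lam)) / f)) *
            (pd ex X P + pd ev X P * a) -
          (pd ex W P + pd ev W P * a) *
            (jet2 X P (0, 1) (0, 1) a a + pd ev X P * (-(σ + a ^ 2 / (2 * lam)) / f))) = 0 := by
  have hT := fun Q (hQ : Q ∈ Ω) => h.T_eq_zero hf hl hf' hQ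
  obtain ⟨hx, hv⟩ := hT P hP
  have hTt := (h.T_t_and_minor_ne_zero hf hl hf' hP).1
  have hj : jet2 T P (0, 1) (0, 1) a a = 0 := by
    simp only [jet2, pd_eq_zero h.isOpen (fun Q hQ => (hT Q hQ).1) _ hP,
      pd_eq_zero h.isOpen (fun Q hQ => (hT Q hQ).2) _ hP]
    ring
  obtain ⟨wt, wx, wtt, wtx, wxx, h0, h1, h2, h3, h4, h5⟩ :=
    h.exists_transformed_jet hf hl hP a σ 0 (by
    rw [hx, hv]
    simpa using ⟨hTt, hX⟩)
  rw [hj] at h5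
  simp only [hx, hv, zero_mul, add_zero, mul_zero, zero_add] at h1 h2 h5
  generalize pd ex X P + pd ev X P * a = Xx at *
  generalize pd et X P + pd ev X P * σ = Xt at *
  rw [h1, h2, h5]
  linear_combination Xx ^ 3 * pd et T P * h0

/-- The coefficient of `σ` in the determining equation gives `f (X_x + X_v a)² = f' T_t` whenever
the left-hand side is nonzero, which forces `X_v = 0`. -/
theorem SendsSolutions.X_equations (hf : f ≠ 0) (hl : lam ≠ 0) (hf' : f' ≠ 0)
    (h : SendsSolutions f lam f' Ω T X W) {P : Space} (hP : P ∈ Ω) :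
    pd ev X P = 0 ∧ pd ex X P ≠ 0 ∧ pd ev W P ≠ 0 ∧ f * pd ex X P ^ 2 = f' * pd et T P := by
  obtain ⟨hTt, hK⟩ := h.T_t_and_minor_ne_zero hf hl hf' hP
  -- the determining equation is affine in `σ`
  have key : ∀ a : ℝ, pd ex X P + pd ev X P * a ≠ 0 →
      f * (pd ex X P + pd ev X P * a) ^ 2 = f' * pd et T P := by
    intro a ha
    have e0 := h.determining_equation hf hl hf' hP a 0 ha
    have e1 := h.determining_equation hf hl hf' hP a 1 ha
    refine mul_left_cancel₀ hK ?_
    field_simp at e0 e1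
    generalize jet2 W P (0, 1) (0, 1) a a = jW at *
    generalize jet2 X P (0, 1) (0, 1) a a = jX at *
    refine mul_left_cancel₀ hl ?_
    linear_combination (e1 - e0) / 2
  have hv : pd ev X P = 0 := by
    by_contra hv
    -- values of `a` for which `X_x + X_v a` is `1` and `2`
    have k1 := key ((1 - pd ex X P) / pd ev X P) (by rw [mul_div_cancel₀ _ hv]; simp)
    have k2 := key ((2 - pd ex X P) / pd ev X P) (by rw [mul_div_cancel₀ _ hv]; simp)
    rw [mul_div_cancel₀ _ hv] at k1 k2
    have : f * 3 = 0 := by linear_combination k2 - k1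
    simp [hf] at this
  rw [hv, zero_mul, sub_zero] at hK
  obtain ⟨hXx, hWv⟩ := ne_zero_and_ne_zero_of_mul hK
  have k := key 0 (by simpa using hXx)
  exact ⟨hv, hXx, hWv, by simpa using k⟩

/-- The coefficients of the powers of `a` in the determining equation. -/
theorem SendsSolutions.W_equations (hf : f ≠ 0) (hl : lam ≠ 0) (hf' : f' ≠ 0)
    (h : SendsSolutions f lam f' Ω T X W) {P : Space} (hP : P ∈ Ω) :
    pd ex (pd ex X) P = 0 ∧ pd ev (pd ev W) P = (2 * f * lam)⁻¹ * pd ev W P ∧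
    2 * f * (pd ex X P * pd ex (pd ev W) P) = pd et X P * pd ev W P ∧
    pd ex X P * pd et W P - pd et X P * pd ex W P + f * (pd ex X P * pd ex (pd ex W) P) = 0 := by
  have hΩ := h.isOpen
  have hX := fun Q (hQ : Q ∈ Ω) => h.X_equations hf hl hf' hQ
  have hT := fun Q (hQ : Q ∈ Ω) => h.T_eq_zero hf hl hf' hQ
  obtain ⟨hv, hXx, hWv, hfT⟩ := hX P hP
  have hXX := hasPd_of_contDiffOn hΩ (contDiffOn_pd hΩ h.X_smooth ex) ex hP
  have hxx : pd ex (pd ex X) P = 0 := by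
    have h1 := (hXX.mul hXX).const_mul f
    have h2 : HasPd ex (fun Q => f * (pd ex X Q * pd ex X Q)) (f' * pd ex (pd et T) P) P :=
      HasPd.congr hΩ hP
        ((hasPd_of_contDiffOn hΩ (contDiffOn_pd hΩ h.T_smooth et) ex hP).const_mul f')
        fun Q hQ => by rw [← (hX Q hQ).2.2.2]; ring
    have h3 := h1.unique h2
    rw [pd_comm hΩ h.T_smooth ex et hP, pd_eq_zero hΩ (fun Q hQ => (hT Q hQ).1) et hP] at h3
    have h4 : 2 * f * pd ex X P ≠ 0 := by positivity
    exact mul_left_cancel₀ h4 (by linear_combination h3)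
  have hjX : ∀ a : ℝ, jet2 X P (0, 1) (0, 1) a a = 0 := fun a => by
    simp only [jet2, pd_comm hΩ h.X_smooth ev ex hP, hxx,
      pd_eq_zero hΩ (fun Q hQ => (hX Q hQ).1) _ hP]
    ring
  have hjW : ∀ a : ℝ, jet2 W P (0, 1) (0, 1) a a =
      pd ex (pd ex W) P + 2 * pd ex (pd ev W) P * a + pd ev (pd ev W) P * a ^ 2 := fun a => by
    simp only [jet2, pd_comm hΩ h.W_smooth ev ex hP]
    ring
  -- the determining equation, divided by `X_x ^ 2`
  have key : ∀ a : ℝ, pd ex X P * pd et W P - pd et X P * (pd ex W P + pd ev W P * a) +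
      f * (pd ex X P * (pd ex (pd ex W) P + 2 * pd ex (pd ev W) P * a + pd ev (pd ev W) P * a ^ 2 +
        pd ev W P * (-(a ^ 2 / (2 * lam)) / f))) = 0 := fun a => by
    have e := h.determining_equation hf hl hf' hP a 0 (by simpa [hv] using hXx)
    rw [hjX, hjW, ← hfT] at e
    simp only [hv, zero_mul, add_zero, mul_zero, zero_add] at e
    refine mul_left_cancel₀ (pow_ne_zero 2 hXx) ?_
    linear_combination e
  have k0 := key 0
  have k1 := key 1
  have k2 := key (-1)
  refine ⟨hxx, ?_, ?_, ?_⟩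
  · have e : 2 * f * lam * pd ev (pd ev W) P = pd ev W P := by
      field_simp at k0 k1 k2
      refine mul_left_cancel₀ hXx ?_
      linear_combination (k1 + k2 - 2 * k0) / 2
    field_simp
    linear_combination e
  · linear_combination (k1 - k2) / 2
  · linear_combination k0

end

/-! ### Integration of the determining equations -/

theorem hasPd_space_t (e p : Space) : HasPd e (fun q : Space => q.1) e.1 p :=
  ⟨differentiableAt_fst, by
    have : fderiv ℝ (fun q : Space => q.1) p = _ := fderiv_fst
    rw [this]; rfl⟩

theorem hasPd_space_x (e p : Space) : HasPd e (fun q : Space => q.2.1) e.2.1 p := by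
  have h : HasFDerivAt (fun q : Space => q.2.1)
      ((ContinuousLinearMap.fst ℝ ℝ ℝ).comp (ContinuousLinearMap.snd ℝ ℝ (ℝ × ℝ))) p :=
    hasFDerivAt_snd.fst
  exact ⟨h.differentiableAt, by rw [h.fderiv]; rfl⟩

theorem hasPd_space_v (e p : Space) : HasPd e (fun q : Space => q.2.2) e.2.2 p := by
  have h : HasFDerivAt (fun q : Space => q.2.2)
      ((ContinuousLinearMap.snd ℝ ℝ ℝ).comp (ContinuousLinearMap.snd ℝ ℝ (ℝ × ℝ))) p :=
    hasFDerivAt_snd.snd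
  exact ⟨h.differentiableAt, by rw [h.fderiv]; rfl⟩

theorem eq_const_of_hasPd {Ω : Set Space} (hΩ : IsOpen Ω) (hc : IsPreconnected Ω) {g : Space → ℝ}
    (ht : ∀ p ∈ Ω, HasPd et g 0 p) (hx : ∀ p ∈ Ω, HasPd ex g 0 p) (hv : ∀ p ∈ Ω, HasPd ev g 0 p) :
    ∃ c, ∀ p ∈ Ω, g p = c := by
  refine hΩ.exists_is_const_of_fderiv_eq_zero hc
    (fun p hp => (ht p hp).1.differentiableWithinAt) fun p hp => ?_
  refine ContinuousLinearMap.ext fun u => ?_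
  rw [clm_space_eq, (ht p hp).2, (hx p hp).2, (hv p hp).2]
  simp

section

variable {f lam f' : ℝ} {Ω : Set Space} {T X W : Space → ℝ}

/-- The functions `g = X_t / X_x` and `g₁ = g_x` and their derivatives. The equation
`g_t = g g_x` is the compatibility condition `(W_v)_tx = (W_v)_xt` of the equations for the
logarithmic derivatives of `W_v`. -/
theorem SendsSolutions.exists_slope (hf : f ≠ 0) (hl : lam ≠ 0) (hf' : f' ≠ 0)
    (h : SendsSolutions f lam f' Ω T X W) :
    ∃ g g₁ : Space → ℝ, ∀ P ∈ Ω,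
      pd et X P = g P * pd ex X P ∧ HasPd et (pd ex X) (g₁ P * pd ex X P) P ∧
      HasPd ex g (g₁ P) P ∧ HasPd ev g 0 P ∧ HasPd et g (g P * g₁ P) P ∧
      HasPd ex g₁ 0 P ∧ HasPd ev g₁ 0 P ∧ HasPd et g₁ (g₁ P ^ 2) P ∧
      2 * f * pd ex (pd ev W) P = g P * pd ev W P ∧
      4 * f * pd et (pd ev W) P = (g P ^ 2 - 2 * f * g₁ P) * pd ev W P ∧
      pd et W P - g P * pd ex W P + f * pd ex (pd ex W) P = 0 := by
  have hΩ := h.isOpen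
  have hX := fun Q (hQ : Q ∈ Ω) => h.X_equations hf hl hf' hQ
  have hW := fun Q (hQ : Q ∈ Ω) => h.W_equations hf hl hf' hQ
  have sX := h.X_smooth
  have sW := h.W_smooth
  have sB := contDiffOn_pd hΩ sW ev
  have sXx := contDiffOn_pd hΩ sX ex
  have sXt := contDiffOn_pd hΩ sX et
  set g : Space → ℝ := fun P => pd et X P / pd ex X P with hg
  have sg : ContDiffOn ℝ ∞ g Ω := sXt.div sXx fun Q hQ => (hX Q hQ).2.1
  set g₁ := pd ex g with hg₁
  have sg₁ : ContDiffOn ℝ ∞ g₁ Ω := contDiffOn_pd hΩ sg ex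
  have D := fun {u : Space → ℝ} (hu : ContDiffOn ℝ ∞ u Ω) (e : Space) {P : Space} (hP : P ∈ Ω) =>
    hasPd_of_contDiffOn hΩ hu e hP
  -- `X_t = g X_x`
  have gX : ∀ Q ∈ Ω, pd et X Q = g Q * pd ex X Q := fun Q hQ => by
    have := (hX Q hQ).2.1
    simp only [hg]; field_simp
  have Xxv : ∀ Q ∈ Ω, pd ev (pd ex X) Q = 0 := fun Q hQ => by
    rw [pd_comm hΩ sX ev ex hQ]; exact pd_eq_zero hΩ (fun R hR => (hX R hR).1) ex hQ
  have Xtv : ∀ Q ∈ Ω, pd ev (pd et X) Q = 0 := fun Q hQ => by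
    rw [pd_comm hΩ sX ev et hQ]; exact pd_eq_zero hΩ (fun R hR => (hX R hR).1) et hQ
  have Xxt : ∀ Q ∈ Ω, pd et (pd ex X) Q = g₁ Q * pd ex X Q := fun Q hQ => by
    rw [pd_comm hΩ sX et ex hQ]
    refine (HasPd.congr hΩ hQ ((D sg ex hQ).mul (D sXx ex hQ)) gX).pd_eq.trans ?_
    rw [(hW Q hQ).1]; ring
  have gv : ∀ Q ∈ Ω, pd ev g Q = 0 := fun Q hQ => by
    refine ((D sXt ev hQ).div (D sXx ev hQ) (hX Q hQ).2.1).pd_eq.trans ?_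
    rw [Xxv Q hQ, Xtv Q hQ]; simp
  have g₁v : ∀ Q ∈ Ω, pd ev g₁ Q = 0 := fun Q hQ => by
    rw [hg₁, pd_comm hΩ sg ev ex hQ]; exact pd_eq_zero hΩ gv ex hQ
  have g₁x : ∀ Q ∈ Ω, pd ex g₁ Q = 0 := fun Q hQ => by
    have h1 : pd ex (pd et (pd ex X)) Q = 0 := by
      rw [pd_comm hΩ sXx ex et hQ]; exact pd_eq_zero hΩ (fun R hR => (hW R hR).1) et hQ
    have h2 := (HasPd.congr hΩ hQ ((D sg₁ ex hQ).mul (D sXx ex hQ)) Xxt).pd_eq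
    rw [h1, (hW Q hQ).1, mul_zero, add_zero] at h2
    exact (mul_eq_zero.1 h2.symm).resolve_right (hX Q hQ).2.1
  -- the equations for `B = W_v`
  have B1 : ∀ Q ∈ Ω, 2 * f * pd ex (pd ev W) Q = g Q * pd ev W Q := fun Q hQ =>
    mul_left_cancel₀ (hX Q hQ).2.1 (by
      linear_combination (hW Q hQ).2.2.1 + pd ev W Q * gX Q hQ)
  have W1 : ∀ Q ∈ Ω, pd et W Q - g Q * pd ex W Q + f * pd ex (pd ex W) Q = 0 := fun Q hQ =>
    mul_left_cancel₀ (hX Q hQ).2.1 (by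
      linear_combination (hW Q hQ).2.2.2 + pd ex W Q * gX Q hQ)
  have B2 : ∀ Q ∈ Ω, pd et (pd ev W) Q - g Q * pd ex (pd ev W) Q +
      f * pd ex (pd ex (pd ev W)) Q = 0 := fun Q hQ => by
    have h1 := (((D (contDiffOn_pd hΩ sW et) ev hQ).sub
      ((D sg ev hQ).mul (D (contDiffOn_pd hΩ sW ex) ev hQ))).add
      ((D (contDiffOn_pd hΩ (contDiffOn_pd hΩ sW ex) ex) ev hQ).const_mul f)).unique
      (HasPd.congr hΩ hQ (HasPd.const ev 0 Q) W1)
    have h2 : pd ev (pd ex (pd ex W)) Q = pd ex (pd ex (pd ev W)) Q := by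
      rw [pd_comm hΩ (contDiffOn_pd hΩ sW ex) ev ex hQ]
      exact pd_congr hΩ hQ fun R hR => pd_comm hΩ sW ev ex hR
    rw [gv Q hQ, pd_comm hΩ sW ev et hQ, pd_comm hΩ sW ev ex hQ, h2] at h1
    linear_combination h1
  have B3 : ∀ Q ∈ Ω, 2 * f * pd ex (pd ex (pd ev W)) Q =
      g₁ Q * pd ev W Q + g Q * pd ex (pd ev W) Q := fun Q hQ =>
    ((D (contDiffOn_pd hΩ sB ex) ex hQ).const_mul (2 * f)).unique
      (HasPd.congr hΩ hQ ((D sg ex hQ).mul (D sB ex hQ)) B1)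
  have B4 : ∀ Q ∈ Ω, 2 * pd et (pd ev W) Q =
      g Q * pd ex (pd ev W) Q - g₁ Q * pd ev W Q := fun Q hQ => by
    linear_combination 2 * B2 Q hQ - B3 Q hQ
  -- the compatibility condition
  have gt : ∀ Q ∈ Ω, pd et g Q = g Q * g₁ Q := fun Q hQ => by
    have h1 := ((D (contDiffOn_pd hΩ sB ex) et hQ).const_mul (2 * f)).unique
      (HasPd.congr hΩ hQ ((D sg et hQ).mul (D sB et hQ)) B1)
    have h2 := ((D (contDiffOn_pd hΩ sB et) ex hQ).const_mul 2).unique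
      (HasPd.congr hΩ hQ (((D sg ex hQ).mul (D (contDiffOn_pd hΩ sB ex) ex hQ)).sub
        ((D sg₁ ex hQ).mul (D sB ex hQ))) B4)
    rw [pd_comm hΩ sB ex et hQ, g₁x Q hQ] at h2
    refine mul_right_cancel₀ (hX Q hQ).2.2.1 ?_
    linear_combination f * h2 - h1 + g Q / 2 * B3 Q hQ - g Q / 2 * B4 Q hQ
  have g₁t : ∀ Q ∈ Ω, pd et g₁ Q = g₁ Q ^ 2 := fun Q hQ => by
    rw [hg₁, pd_comm hΩ sg et ex hQ,
      (HasPd.congr hΩ hQ ((D sg ex hQ).mul (D sg₁ ex hQ)) gt).pd_eq, g₁x Q hQ]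
    ring
  refine ⟨g, g₁, fun P hP => ⟨gX P hP, (D sXx et hP).of_eq (Xxt P hP), D sg ex hP,
    (D sg ev hP).of_eq (gv P hP), (D sg et hP).of_eq (gt P hP), (D sg₁ ex hP).of_eq (g₁x P hP),
    (D sg₁ ev hP).of_eq (g₁v P hP), (D sg₁ et hP).of_eq (g₁t P hP), B1 P hP, ?_, W1 P hP⟩⟩
  linear_combination 2 * f * B4 P hP + g P * B1 P hP

/-- The components `T` and `X` are linear fractional with a common denominator, which is normalized
to `1 / X_x`, so that `κ = 1`. -/
theorem SendsSolutions.exists_params (hf : f ≠ 0) (hl : lam ≠ 0) (hf' : f' ≠ 0)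
    (h : SendsSolutions f lam f' Ω T X W) (hc : IsPreconnected Ω) (hne : Ω.Nonempty) :
    ∃ Q : Params, Q.κ = 1 ∧ Q.Δ = f / f' ∧ ∀ P ∈ Ω, Q.r P.1 ≠ 0 ∧
      T P = (Q.α * P.1 + Q.β) / Q.r P.1 ∧
      X P = (Q.κ * P.2.1 + Q.μ₁ * P.1 + Q.μ₀) / Q.r P.1 ∧
      2 * f * pd ex (pd ev W) P = Q.g (P.1, P.2.1) * pd ev W P ∧
      4 * f * pd et (pd ev W) P =
        (Q.g (P.1, P.2.1) ^ 2 + 2 * f * (Q.γ / Q.r P.1)) * pd ev W P ∧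
      pd et W P - Q.g (P.1, P.2.1) * pd ex W P + f * pd ex (pd ex W) P = 0 := by
  obtain ⟨g, g₁, hg⟩ := h.exists_slope hf hl hf'
  have hΩ := h.isOpen
  have hX := fun Q (hQ : Q ∈ Ω) => h.X_equations hf hl hf' hQ
  have hW := fun Q (hQ : Q ∈ Ω) => h.W_equations hf hl hf' hQ
  have hT := fun Q (hQ : Q ∈ Ω) => h.T_eq_zero hf hl hf' hQ
  have D := fun {u : Space → ℝ} (hu : ContDiffOn ℝ ∞ u Ω) (e : Space) {P : Space} (hP : P ∈ Ω) =>
    hasPd_of_contDiffOn hΩ hu e hP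
  have sXx := contDiffOn_pd hΩ h.X_smooth ex
  -- `1 / X_x` is an affine function of `t`
  set R : Space → ℝ := fun P => (pd ex X P)⁻¹ with hR
  have R0 : ∀ P ∈ Ω, R P ≠ 0 := fun P hP => inv_ne_zero (hX P hP).2.1
  have RX : ∀ P ∈ Ω, pd ex X P = (R P)⁻¹ := fun P _ => (inv_inv _).symm
  have Rx : ∀ P ∈ Ω, HasPd ex R 0 P := fun P hP =>
    ((D sXx ex hP).inv (hX P hP).2.1).of_eq (by rw [(hW P hP).1]; simp)
  have Rv : ∀ P ∈ Ω, HasPd ev R 0 P := fun P hP =>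
    ((D sXx ev hP).inv (hX P hP).2.1).of_eq (by
      rw [pd_comm hΩ h.X_smooth ev ex hP, pd_eq_zero hΩ (fun R hR => (hX R hR).1) ex hP]; simp)
  have Rt : ∀ P ∈ Ω, HasPd et R (-(g₁ P * R P)) P := fun P hP =>
    ((hg P hP).2.1.inv (hX P hP).2.1).of_eq (by
      have := (hX P hP).2.1
      simp only [hR]; field_simp)
  obtain ⟨γ, hγ⟩ : ∃ γ, ∀ P ∈ Ω, -1 * (g₁ P * R P) = γ := by
    refine eq_const_of_hasPd hΩ hc (fun P hP => ?_) (fun P hP => ?_) (fun P hP => ?_) <;>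
    obtain ⟨-, -, -, -, -, g1x, g1v, g1t, -⟩ := hg P hP
    · exact ((g1t.mul (Rt P hP)).const_mul (-1)).of_eq (by ring)
    · exact ((g1x.mul (Rx P hP)).const_mul (-1)).of_eq (by ring)
    · exact ((g1v.mul (Rv P hP)).const_mul (-1)).of_eq (by ring)
  have hg₁ : ∀ P ∈ Ω, g₁ P = -γ / R P := fun P hP => by
    have := R0 P hP
    field_simp
    linear_combination -hγ P hP
  have Rt' : ∀ P ∈ Ω, HasPd et R γ P := fun P hP =>
    (Rt P hP).of_eq (by linear_combination hγ P hP)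
  obtain ⟨δ, hδ⟩ : ∃ δ, ∀ P ∈ Ω, R P - γ * P.1 = δ := by
    refine eq_const_of_hasPd hΩ hc (fun P hP => ?_) (fun P hP => ?_) (fun P hP => ?_)
    · exact ((Rt' P hP).sub ((hasPd_space_t et P).const_mul γ)).of_eq (by simp)
    · exact ((Rx P hP).sub ((hasPd_space_t ex P).const_mul γ)).of_eq (by simp)
    · exact ((Rv P hP).sub ((hasPd_space_t ev P).const_mul γ)).of_eq (by simp)
  -- `T R` is an affine function of `t`
  have Tt : ∀ P ∈ Ω, HasPd et T (f / f' / R P ^ 2) P := fun P hP =>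
    (D h.T_smooth et hP).of_eq (by
      have h1 := (hX P hP).2.2.2
      have h2 := R0 P hP
      rw [RX P hP] at h1
      field_simp at h1 ⊢
      linear_combination -h1)
  have Tx : ∀ P ∈ Ω, HasPd ex T 0 P := fun P hP => (D h.T_smooth ex hP).of_eq (hT P hP).1
  have Tv : ∀ P ∈ Ω, HasPd ev T 0 P := fun P hP => (D h.T_smooth ev hP).of_eq (hT P hP).2
  obtain ⟨α, hα⟩ : ∃ α, ∀ P ∈ Ω, f / f' * (R P)⁻¹ + γ * T P = α := by
    refine eq_const_of_hasPd hΩ hc (fun P hP => ?_) (fun P hP => ?_) (fun P hP => ?_)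
    · exact ((((Rt' P hP).inv (R0 P hP)).const_mul _).add ((Tt P hP).const_mul γ)).of_eq (by ring)
    · exact ((((Rx P hP).inv (R0 P hP)).const_mul _).add ((Tx P hP).const_mul γ)).of_eq (by simp)
    · exact ((((Rv P hP).inv (R0 P hP)).const_mul _).add ((Tv P hP).const_mul γ)).of_eq (by simp)
  obtain ⟨β, hβ⟩ : ∃ β, ∀ P ∈ Ω, T P * R P - α * P.1 = β := by
    refine eq_const_of_hasPd hΩ hc (fun P hP => ?_) (fun P hP => ?_) (fun P hP => ?_)
    · refine (((Tt P hP).mul (Rt' P hP)).sub ((hasPd_space_t et P).const_mul α)).of_eq ?_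
      have := R0 P hP
      rw [← hα P hP]
      field_simp
      ring
    · exact (((Tx P hP).mul (Rx P hP)).sub ((hasPd_space_t ex P).const_mul α)).of_eq (by simp)
    · exact (((Tv P hP).mul (Rv P hP)).sub ((hasPd_space_t ev P).const_mul α)).of_eq (by simp)
  -- `X R` is an affine function of `(t, x)`, and so is `g R`
  have Xt : ∀ P ∈ Ω, HasPd et X (g P / R P) P := fun P hP =>
    (D h.X_smooth et hP).of_eq (by rw [(hg P hP).1, RX P hP]; rfl)
  have Xx : ∀ P ∈ Ω, HasPd ex X (R P)⁻¹ P := fun P hP => (D h.X_smooth ex hP).of_eq (RX P hP)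
  have Xv : ∀ P ∈ Ω, HasPd ev X 0 P := fun P hP => (D h.X_smooth ev hP).of_eq (hX P hP).1
  have gt : ∀ P ∈ Ω, HasPd et g (-(γ * g P / R P)) P := fun P hP =>
    (hg P hP).2.2.2.2.1.of_eq (by rw [hg₁ P hP]; ring)
  have gx : ∀ P ∈ Ω, HasPd ex g (-γ / R P) P := fun P hP =>
    (hg P hP).2.2.1.of_eq (hg₁ P hP)
  have gv : ∀ P ∈ Ω, HasPd ev g 0 P := fun P hP => (hg P hP).2.2.2.1
  obtain ⟨m, hm⟩ : ∃ m, ∀ P ∈ Ω, g P * R P + γ * P.2.1 = m := by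
    refine eq_const_of_hasPd hΩ hc (fun P hP => ?_) (fun P hP => ?_) (fun P hP => ?_) <;>
    have := R0 P hP
    · refine (((gt P hP).mul (Rt' P hP)).add ((hasPd_space_x et P).const_mul γ)).of_eq ?_
      field_simp; ring
    · refine (((gx P hP).mul (Rx P hP)).add ((hasPd_space_x ex P).const_mul γ)).of_eq ?_
      field_simp; ring
    · exact (((gv P hP).mul (Rv P hP)).add ((hasPd_space_x ev P).const_mul γ)).of_eq (by simp)
  obtain ⟨μ₁, hμ₁⟩ : ∃ μ₁, ∀ P ∈ Ω, g P + γ * X P = μ₁ := by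
    refine eq_const_of_hasPd hΩ hc (fun P hP => ?_) (fun P hP => ?_) (fun P hP => ?_)
    · exact ((gt P hP).add ((Xt P hP).const_mul γ)).of_eq (by ring)
    · exact ((gx P hP).add ((Xx P hP).const_mul γ)).of_eq (by ring)
    · exact ((gv P hP).add ((Xv P hP).const_mul γ)).of_eq (by ring)
  obtain ⟨μ₀, hμ₀⟩ : ∃ μ₀, ∀ P ∈ Ω, X P * R P - P.2.1 - μ₁ * P.1 = μ₀ := by
    refine eq_const_of_hasPd hΩ hc (fun P hP => ?_) (fun P hP => ?_) (fun P hP => ?_) <;>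
    have := R0 P hP
    · refine ((((Xt P hP).mul (Rt' P hP)).sub (hasPd_space_x et P)).sub
        ((hasPd_space_t et P).const_mul μ₁)).of_eq ?_
      rw [← hμ₁ P hP]
      field_simp; ring
    · refine ((((Xx P hP).mul (Rx P hP)).sub (hasPd_space_x ex P)).sub
        ((hasPd_space_t ex P).const_mul μ₁)).of_eq ?_
      field_simp; ring
    · exact ((((Xv P hP).mul (Rv P hP)).sub (hasPd_space_x ev P)).sub
        ((hasPd_space_t ev P).const_mul μ₁)).of_eq (by simp)
  have hRr : ∀ P ∈ Ω, γ * P.1 + δ = R P := fun P hP => by linear_combination -hδ P hP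
  refine ⟨⟨α, β, γ, δ, 1, μ₁, μ₀⟩, rfl, ?_, fun P hP => ?_⟩
  · obtain ⟨P, hP⟩ := hne
    have h1 := hα P hP
    have h2 := hβ P hP
    have h0 := R0 P hP
    have h3 : f / f' + γ * (T P * R P) = α * R P := by
      rw [← h1]; field_simp
    simp only [Params.Δ]
    linear_combination -h3 + α * hRr P hP + γ * h2
  · have h0 := R0 P hP
    have hgP : Params.g ⟨α, β, γ, δ, 1, μ₁, μ₀⟩ (P.1, P.2.1) = g P := by
      simp only [Params.g, Params.N, Params.r, hRr P hP]
      field_simp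
      linear_combination γ * hμ₀ P hP + μ₁ * hRr P hP - R P * hμ₁ P hP
    obtain ⟨-, -, -, -, -, -, -, -, b1, b2, b3⟩ := hg P hP
    rw [hgP]
    simp only [Params.r, hRr P hP]
    refine ⟨h0, ?_, ?_, b1, ?_, b3⟩
    · field_simp
      linear_combination hβ P hP
    · field_simp
      linear_combination hμ₀ P hP
    · rw [b2, hg₁ P hP]; ring

theorem hasPd_lift {u : ℝ × ℝ → ℝ} {P : Space} (hu : DifferentiableAt ℝ u (P.1, P.2.1))
    (e : Space) :
    HasPd e (fun Q : Space => u (Q.1, Q.2.1))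
      (pd (1, 0) u (P.1, P.2.1) * e.1 + pd (0, 1) u (P.1, P.2.1) * e.2.1) P :=
  HasPd.comp2 (h := u) hu (hasPd_space_t e P) (hasPd_space_x e P)

/-- The derivative `W_v` has the same logarithmic derivatives as `F¹ exp (v / (2 f λ))`. -/
theorem SendsSolutions.exists_F1_coefficient (hf : f ≠ 0) (hl : lam ≠ 0) (hf' : f' ≠ 0)
    (h : SendsSolutions f lam f' Ω T X W) (hc : IsPreconnected Ω) (hne : Ω.Nonempty)
    {Q : Params} (hκ : Q.κ = 1)
    (hQ : ∀ P ∈ Ω, Q.r P.1 ≠ 0 ∧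
      2 * f * pd ex (pd ev W) P = Q.g (P.1, P.2.1) * pd ev W P ∧
      4 * f * pd et (pd ev W) P =
        (Q.g (P.1, P.2.1) ^ 2 + 2 * f * (Q.γ / Q.r P.1)) * pd ev W P) :
    ∃ k : ℝ, k ≠ 0 ∧ ∀ P ∈ Ω, pd ev W P =
      (2 * f * lam)⁻¹ * (Q.F1 k f P.1 P.2.1 * Real.exp (P.2.2 / (2 * f * lam))) := by
  have hΩ := h.isOpen
  have hκ0 : Q.κ ≠ 0 := by simp [hκ]
  have sB := contDiffOn_pd hΩ h.W_smooth ev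
  have hE : ∀ P ∈ Ω, ∀ e : Space, HasPd e
      (fun P => Real.exp (-1 * (Q.S f (P.1, P.2.1) + (2 * f * lam)⁻¹ * P.2.2)))
      (Real.exp (-1 * (Q.S f (P.1, P.2.1) + (2 * f * lam)⁻¹ * P.2.2)) * (-1 *
        ((Q.N P.2.1 ^ 2 / (4 * f * Q.κ ^ 2 * Q.r P.1 ^ 2) + Q.γ / (2 * Q.r P.1)) * e.1 -
        Q.N P.2.1 / (2 * f * Q.κ * Q.r P.1) * e.2.1 + (2 * f * lam)⁻¹ * e.2.2))) P := by
    intro P hP e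
    have hr := (hQ P hP).1
    have h1 := hasPd_lift (P := P) (Q.hasPd_S (p := (P.1, P.2.1)) hf hκ0 hr (1, 0)).1 e
    refine ((h1.add ((hasPd_space_v e P).const_mul (2 * f * lam)⁻¹)).const_mul (-1)).exp.of_eq ?_
    rw [(Q.hasPd_S (p := (P.1, P.2.1)) hf hκ0 hr (1, 0)).pd_eq,
      (Q.hasPd_S (p := (P.1, P.2.1)) hf hκ0 hr (0, 1)).pd_eq]
    simp only
    ring
  obtain ⟨k₀, hk₀⟩ : ∃ k₀, ∀ P ∈ Ω, pd ev W P *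
      Real.exp (-1 * (Q.S f (P.1, P.2.1) + (2 * f * lam)⁻¹ * P.2.2)) = k₀ := by
    refine eq_const_of_hasPd hΩ hc (fun P hP => ?_) (fun P hP => ?_) (fun P hP => ?_) <;>
    obtain ⟨hr, b1, b2⟩ := hQ P hP
    · refine ((hasPd_of_contDiffOn hΩ sB et hP).mul (hE P hP et)).of_eq ?_
      have : pd et (pd ev W) P =
          (Q.N P.2.1 ^ 2 / (4 * f * Q.κ ^ 2 * Q.r P.1 ^ 2) + Q.γ / (2 * Q.r P.1)) * pd ev W P := by
        rw [Params.g, hκ] at b2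
        rw [hκ]
        simp only at b2
        field_simp at b2 ⊢
        linear_combination 2 * b2
      rw [this]
      simp only
      ring
    · refine ((hasPd_of_contDiffOn hΩ sB ex hP).mul (hE P hP ex)).of_eq ?_
      have : pd ex (pd ev W) P = -(Q.N P.2.1 / (2 * f * Q.κ * Q.r P.1)) * pd ev W P := by
        rw [Params.g, hκ] at b1
        rw [hκ]
        simp only at b1
        field_simp at b1 ⊢
        linear_combination b1
      rw [this]
      simp only
      ring
    · refine ((hasPd_of_contDiffOn hΩ sB ev hP).mul (hE P hP ev)).of_eq ?_
      rw [(h.W_equations hf hl hf' hP).2.1]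
      simp only
      ring
  have hk : k₀ ≠ 0 := by
    obtain ⟨P, hP⟩ := hne
    rw [← hk₀ P hP]
    exact mul_ne_zero (h.X_equations hf hl hf' hP).2.2.1 (Real.exp_pos _).ne'
  refine ⟨2 * f * lam * k₀, by positivity, fun P hP => ?_⟩
  rw [Q.F1_eq (q := (P.1, P.2.1)) _ f (hQ P hP).1, ← hk₀ P hP, mul_assoc _ (Real.exp _),
    ← Real.exp_add, mul_assoc (2 * f * lam), inv_mul_cancel_left₀ (by positivity), mul_assoc,
    ← Real.exp_add]
  have : -1 * (Q.S f (P.1, P.2.1) + (2 * f * lam)⁻¹ * P.2.2) +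
      (Q.S f (P.1, P.2.1) + P.2.2 / (2 * f * lam)) = 0 := by ring
  rw [this, Real.exp_zero, mul_one]

/-- On a convex domain, the parts of the domain with fixed `(t, x)` are intervals. -/
theorem eq_of_pd_ev_eq_zero (hΩ : IsOpen Ω) (hc : Convex ℝ Ω) {Y : Space → ℝ}
    (hY : ∀ P ∈ Ω, HasPd ev Y 0 P) {t x v v' : ℝ} (h : (t, x, v) ∈ Ω) (h' : (t, x, v') ∈ Ω) :
    Y (t, x, v) = Y (t, x, v') := by
  set I : Set ℝ := {s | (t, x, s) ∈ Ω}
  have hI : IsOpen I := hΩ.preimage (by fun_prop : Continuous fun s : ℝ => ((t, x, s) : Space))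
  have hIc : Convex ℝ I := by
    intro a ha b hb p q hp hq hpq
    have := hc ha hb hp hq hpq
    have e : p • ((t, x, a) : Space) + q • ((t, x, b) : Space) = (t, x, p • a + q • b) := by
      refine Prod.ext ?_ (Prod.ext ?_ rfl)
      · change p * t + q * t = t
        rw [← add_mul, hpq, one_mul]
      · change p * x + q * x = x
        rw [← add_mul, hpq, one_mul]
    rw [e] at this
    exact this
  have hd : ∀ s ∈ I, HasDerivAt (fun s => Y (t, x, s)) 0 s := by
    intro s hs
    have h1 : HasDerivAt (fun s : ℝ => ((t, x, s) : Space)) (0, 0, 1) s :=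
      (hasDerivAt_const s t).prodMk ((hasDerivAt_const s x).prodMk (hasDerivAt_id s))
    have h2 := (hY (t, x, s) hs).1.hasFDerivAt.comp_hasDerivAt s h1
    rw [(hY (t, x, s) hs).2] at h2
    exact h2
  exact hI.is_const_of_deriv_eq_zero hIc.isPreconnected
    (fun s hs => (hd s hs).differentiableAt.differentiableWithinAt)
    (fun s hs => (hd s hs).deriv) h h'

/-- The derivatives of the restriction of `g` to a plane of constant `v`. -/
theorem hasPd_section {g : Space → ℝ} {q : ℝ × ℝ} {v : ℝ} (hg : DifferentiableAt ℝ g (q.1, q.2, v))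
    (e : ℝ × ℝ) :
    HasPd e (fun q : ℝ × ℝ => g (q.1, q.2, v))
      (pd et g (q.1, q.2, v) * e.1 + pd ex g (q.1, q.2, v) * e.2) q :=
  (HasPd.comp3 (h := g) hg (hasPd_fst e q) (hasPd_snd e q) (HasPd.const e v q)).of_eq (by ring)

/-- The function `W / F¹ - exp (v / (2 f λ))` does not depend on `v`, and it solves the linear
equation because `W` satisfies `W_t - g W_x + f W_xx = 0` at each fixed `v`. -/
theorem SendsSolutions.exists_F0 (hf : f ≠ 0) (hl : lam ≠ 0)
    (h : SendsSolutions f lam f' Ω T X W) (hc : Convex ℝ Ω) {Q : Params} (hκ : Q.κ ≠ 0)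
    {k : ℝ} (hk : k ≠ 0)
    (hQ : ∀ P ∈ Ω, Q.r P.1 ≠ 0 ∧
      pd et W P - Q.g (P.1, P.2.1) * pd ex W P + f * pd ex (pd ex W) P = 0 ∧
      pd ev W P = (2 * f * lam)⁻¹ * (Q.F1 k f P.1 P.2.1 * Real.exp (P.2.2 / (2 * f * lam)))) :
    ∃ F0 : ℝ × ℝ → ℝ, IsHeatSolution f F0 ((fun q : Space => (q.1, q.2.1)) '' Ω) ∧
      ∀ P ∈ Ω, W P = Q.F1 k f P.1 P.2.1 * (Real.exp (P.2.2 / (2 * f * lam)) + F0 (P.1, P.2.1)) := by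
  have hΩ := h.isOpen
  set H : ℝ × ℝ → ℝ := fun q => Q.F1 k f q.1 q.2 with hHdef
  have hH0 : ∀ P ∈ Ω, H (P.1, P.2.1) ≠ 0 := fun P hP =>
    Q.F1_ne_zero (q := (P.1, P.2.1)) hk (hQ P hP).1
  set Y : Space → ℝ := fun P =>
    W P / H (P.1, P.2.1) - Real.exp ((2 * f * lam)⁻¹ * P.2.2) with hYdef
  have hYv : ∀ P ∈ Ω, HasPd ev Y 0 P := by
    intro P hP
    have h1 := hasPd_lift (P := P) (u := H)
      (Q.hasPd_F1 (p := (P.1, P.2.1)) hf hκ k (hQ P hP).1 (1, 0)).1 ev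
    refine (((hasPd_of_contDiffOn hΩ h.W_smooth ev hP).div h1 (hH0 P hP)).sub
      ((hasPd_space_v ev P).const_mul (2 * f * lam)⁻¹).exp).of_eq ?_
    have h2 := hH0 P hP
    have h3 := (hQ P hP).2.2
    rw [h3, div_eq_inv_mul P.2.2]
    simp only [hHdef] at h2 ⊢
    field_simp
    ring
  classical
  set F0 : ℝ × ℝ → ℝ := fun q =>
    if hq : ∃ v, (q.1, q.2, v) ∈ Ω then Y (q.1, q.2, hq.choose) else 0 with hF0def
  have hF0 : ∀ P ∈ Ω, F0 (P.1, P.2.1) = Y P := by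
    intro P hP
    have hq : ∃ v, (P.1, P.2.1, v) ∈ Ω := ⟨P.2.2, hP⟩
    simp only [hF0def, dif_pos hq]
    exact eq_of_pd_ev_eq_zero hΩ hc hYv hq.choose_spec hP
  have hform : ∀ P ∈ Ω, W P =
      H (P.1, P.2.1) * (Real.exp (P.2.2 / (2 * f * lam)) + F0 (P.1, P.2.1)) := by
    intro P hP
    have h2 := hH0 P hP
    rw [hF0 P hP, hYdef, div_eq_inv_mul P.2.2]
    field_simp
    ring
  refine ⟨F0, ?_, hform⟩
  have hloc : ∀ P ∈ Ω, IsHeatSolution f F0 {q | (q.1, q.2, P.2.2) ∈ Ω} := by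
    intro P _
    set v := P.2.2
    set D : Set (ℝ × ℝ) := {q | (q.1, q.2, v) ∈ Ω} with hDdef
    have hι : ContDiff ℝ ∞ fun q : ℝ × ℝ => ((q.1, q.2, v) : Space) := by fun_prop
    have hD : IsOpen D := hΩ.preimage hι.continuous
    have hDr : D ⊆ {q | Q.r q.1 ≠ 0} := fun q hq => (hQ _ hq).1
    have sH : ContDiffOn ℝ ∞ H D := (Q.contDiffOn_F1 hf hκ k).mono hDr
    have sZ : ContDiffOn ℝ ∞ (fun q : ℝ × ℝ => W (q.1, q.2, v)) D :=
      h.W_smooth.comp hι.contDiffOn fun q hq => hq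
    have sF0 : ContDiffOn ℝ ∞ F0 D := by
      refine ((sZ.div sH fun q hq => hH0 _ hq).sub
        (contDiffOn_const (c := Real.exp ((2 * f * lam)⁻¹ * v)))).congr fun q hq => ?_
      exact hF0 _ hq
    rw [isHeatSolution_iff hD sF0]
    intro p hp
    set E := Real.exp (v / (2 * f * lam))
    have e1 := heat_mul (f := f) hD (H := H) (Y := fun q => E + F0 q) (g := Q.g) sH
      (contDiffOn_const.add sF0) (fun q hq => Q.F1_x hf hκ k (hDr hq))
      (fun q hq => Q.F1_heat hf hκ k (hDr hq)) hp
    have hZ : ∀ q ∈ D, H q * (E + F0 q) = W (q.1, q.2, v) := fun q hq => (hform _ hq).symm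
    have hWd : ∀ q ∈ D, DifferentiableAt ℝ W (q.1, q.2, v) := fun q hq =>
      (hasPd_of_contDiffOn hΩ h.W_smooth et hq).1
    have hZx : ∀ q ∈ D, pd (0, 1) (fun q => H q * (E + F0 q)) q = pd ex W (q.1, q.2, v) :=
      fun q hq => (HasPd.congr hD hq ((hasPd_section (hWd q hq) (0, 1)).of_eq (by simp)) hZ).pd_eq
    have hZt : pd (1, 0) (fun q => H q * (E + F0 q)) p = pd et W (p.1, p.2, v) :=
      (HasPd.congr hD hp ((hasPd_section (hWd p hp) (1, 0)).of_eq (by simp)) hZ).pd_eq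
    have hZxx : pd (0, 1) (pd (0, 1) (fun q => H q * (E + F0 q))) p =
        pd ex (pd ex W) (p.1, p.2, v) :=
      (HasPd.congr hD hp ((hasPd_section
        (hasPd_of_contDiffOn hΩ (contDiffOn_pd hΩ h.W_smooth ex) et hp).1 (0, 1)).of_eq (by simp))
        hZx).pd_eq
    have hE1 : ∀ e : ℝ × ℝ, ∀ q ∈ D, pd e (fun q => E + F0 q) q = pd e F0 q := fun e q hq =>
      (((HasPd.const e E q).add (hasPd_of_contDiffOn hD sF0 e hq)).of_eq (zero_add _)).pd_eq
    rw [hZx p hp, hZt, hZxx, hE1 _ p hp, pd_congr hD hp (hE1 (0, 1))] at e1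
    have h0 : _ = (0 : ℝ) := (hQ _ hp).2.1
    rw [h0] at e1
    exact (mul_eq_zero.1 e1.symm).resolve_left (hH0 _ hp)
  constructor
  · rintro _ ⟨P, hP, rfl⟩
    have hD : IsOpen {q : ℝ × ℝ | (q.1, q.2, P.2.2) ∈ Ω} :=
      hΩ.preimage (by fun_prop : Continuous fun q : ℝ × ℝ => ((q.1, q.2, P.2.2) : Space))
    exact ((hloc P hP).1.contDiffAt (hD.mem_nhds hP)).contDiffWithinAt
  · rintro _ ⟨P, hP, rfl⟩
    exact (hloc P hP).2 _ hP

end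

/-! ### Transformations of the two classes -/

theorem MapsEquation.exists_hasForm {f lam f' lam' : ℝ} (hf : f ≠ 0) (hl : lam ≠ 0) (hf' : f' ≠ 0)
    (hl' : lam' ≠ 0) {φ : Space → Space} {Ω : Set Space} (hc : Convex ℝ Ω) (hne : Ω.Nonempty)
    (h : MapsEquation f lam f' lam' φ Ω) :
    ∃ (P : Params) (k : ℝ) (F0 : ℝ × ℝ → ℝ), HasForm f lam f' lam' φ Ω P k F0 := by
  have hs := h.sendsSolutions hf' hl'
  obtain ⟨Q, hκ, hΔ, hQ⟩ := hs.exists_params hf hl hf' hc.isPreconnected hne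
  obtain ⟨k, hk, hkQ⟩ := hs.exists_F1_coefficient hf hl hf' hc.isPreconnected hne hκ fun P hP =>
    ⟨(hQ P hP).1, (hQ P hP).2.2.2.1, (hQ P hP).2.2.2.2.1⟩
  have hκ0 : Q.κ ≠ 0 := by simp [hκ]
  obtain ⟨F0, hF0, hW⟩ := hs.exists_F0 hf hl hc hκ0 hk fun P hP =>
    ⟨(hQ P hP).1, (hQ P hP).2.2.2.2.2, hkQ P hP⟩
  refine ⟨Q, k, F0, ⟨?_, hκ0, hk, hF0, fun t x v hP => (hQ _ hP).1, fun t x v hP h0 => ?_, ?_,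
    fun t x v hP => ?_⟩⟩
  · rw [hΔ]; positivity
  · have h1 := hW _ hP
    simp only [h0, mul_zero] at h1
    exact (Real.exp_pos _).ne' h1
  · rw [hκ, hΔ]; field_simp
  · obtain ⟨-, hT, hX, -⟩ := hQ _ hP
    refine Prod.ext hT (Prod.ext hX ?_)
    have h1 := hW _ hP
    simp only at h1 ⊢
    rw [← h1, abs_of_pos (Real.exp_pos _), Real.log_exp, hκ, hΔ]
    field_simp

section Classes

variable {E : Type} [NormedAddCommGroup E] [NormedSpace ℝ E]

theorem EqClass.IsGenEquiv.isExplicit {C : EqClass E} (hf : ∀ θ ∈ C.S, C.f θ ≠ 0)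
    (hl : ∀ θ ∈ C.S, C.lam θ ≠ 0) {A : Space × E → Space × E} {O : Set (Space × E)}
    (hO : ∀ θ, Convex ℝ (slice O θ)) (h : C.IsGenEquiv A O) : C.IsExplicit A O := by
  intro θ hθ
  obtain ⟨θ', hθ', h1, h2⟩ := h.2.2 θ hθ
  -- over a value that is not met by the domain, the identity transformation serves
  rcases (slice O θ).eq_empty_or_nonempty with he | hne
  · refine ⟨θ, hθ, fun q hq => by simp [he] at hq, ⟨1, 0, 0, 1, 1, 0, 0⟩, 1, 0, ?_⟩
    rw [he]
    exact ⟨by simp [Params.Δ], one_ne_zero, one_ne_zero,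
      by rw [Set.image_empty]; exact ⟨contDiffOn_empty, by simp⟩, by simp, by simp,
      by simp [Params.Δ], by simp⟩
  · exact ⟨θ', hθ', h1, h2.exists_hasForm (hf θ hθ) (hl θ hθ) (hf θ' hθ') (hl θ' hθ') (hO θ) hne⟩

end Classes

theorem classP1_isNormalizedGen : classP1.IsNormalizedGen := by
  refine EqClass.isNormalizedGen_of_scaling isOpen_ne fun f (hf : f ≠ 0) f' (hf' : f' ≠ 0) => ?_
  refine ⟨fun η => η / f, fun _ => 1,
    ContinuousLinearEquiv.unitsEquivAut ℝ (Units.mk0 (f' / f) (div_ne_zero hf' hf)),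
    contDiffOn_id.div_const _, contDiffOn_const, div_self hf, rfl, ?_, fun η (hη : η ≠ 0) => ?_⟩
  · simp; field_simp
  · refine ⟨div_ne_zero hη hf, one_ne_zero, ?_, ?_, ?_, ?_, ?_⟩
    · change _ ≠ (0 : ℝ)
      simp [hη, hf, hf']
    · change η = η / f * f
      field_simp
    · simp [classP1]
    · simp [classP1]; field_simp
    · simp [classP1]

theorem classP1ext_isNormalizedGen : classP1ext.IsNormalizedGen := by
  refine EqClass.isNormalizedGen_of_scaling
    ((isOpen_ne_fun continuous_fst continuous_const).inter
      (isOpen_ne_fun continuous_snd continuous_const)) ?_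
  rintro ⟨f, lam⟩ ⟨hf, hl⟩ ⟨f', lam'⟩ ⟨hf', hl'⟩
  simp only at hf hl hf' hl'
  refine ⟨fun η => η.1 / f, fun η => η.2 / lam,
    (ContinuousLinearEquiv.unitsEquivAut ℝ (Units.mk0 (f' / f) (div_ne_zero hf' hf))).prodCongr
    (ContinuousLinearEquiv.unitsEquivAut ℝ (Units.mk0 (lam' / lam) (div_ne_zero hl' hl))),
    contDiffOn_fst.div_const _, contDiffOn_snd.div_const _, div_self hf, div_self hl, ?_, ?_⟩
  · simp; constructor <;> field_simp
  · rintro ⟨a, b⟩ ⟨ha, hb⟩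
    simp only at ha hb
    refine ⟨div_ne_zero ha hf, div_ne_zero hb hl, ⟨?_, ?_⟩, ?_, ?_, ?_, ?_⟩
    · simp [ha, hf, hf']
    · simp [hb, hl, hl']
    · change a = a / f * f
      field_simp
    · change b = b / lam * lam
      field_simp
    · simp [classP1ext]; field_simp
    · simp [classP1ext]; field_simp

end PotBurgers

theorem proposition4 :
    -- the class with the arbitrary element `f`, in the gauge `λ = 1`
    (PotBurgers.classP1.IsNormalizedGen ∧
      ∀ (A : PotBurgers.Space × ℝ → PotBurgers.Space × ℝ) (O : Set (PotBurgers.Space × ℝ)),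
        PotBurgers.IsPointTransformation A O → (∀ p ∈ O, p.2 ∈ PotBurgers.classP1.S) →
        (∀ f, Convex ℝ (PotBurgers.slice O f)) →
        (PotBurgers.classP1.IsGenEquiv A O ↔ PotBurgers.classP1.IsExplicit A O)) ∧
    -- the class with the arbitrary element `(f, λ)`
    (PotBurgers.classP1ext.IsNormalizedGen ∧
      ∀ (A : PotBurgers.Space × (ℝ × ℝ) → PotBurgers.Space × (ℝ × ℝ))
        (O : Set (PotBurgers.Space × (ℝ × ℝ))),
        PotBurgers.IsPointTransformation A O → (∀ p ∈ O, p.2 ∈ PotBurgers.classP1ext.S) →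
        (∀ θ, Convex ℝ (PotBurgers.slice O θ)) →
        (PotBurgers.classP1ext.IsGenEquiv A O ↔ PotBurgers.classP1ext.IsExplicit A O)) ∧
    -- the constants `α, β, γ, δ, κ, μ₁, μ₀` are defined up to a nonzero multiplier
    (∀ (f lam f' lam' : ℝ) (φ : PotBurgers.Space → PotBurgers.Space) (Ω : Set PotBurgers.Space)
      (P : PotBurgers.Params) (k : ℝ) (F0 : ℝ × ℝ → ℝ),
      f ≠ 0 → lam ≠ 0 → lam' ≠ 0 → IsOpen Ω → Ω.Nonempty →
      PotBurgers.HasForm f lam f' lam' φ Ω P k F0 →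
      ∀ P' : PotBurgers.Params,
        (∃ (k' : ℝ) (F0' : ℝ × ℝ → ℝ), PotBurgers.HasForm f lam f' lam' φ Ω P' k' F0') ↔
          ∃ c : ℝ, c ≠ 0 ∧ P' = PotBurgers.Params.scale c P) := by
  refine ⟨⟨PotBurgers.classP1_isNormalizedGen, fun A O hA hS hO => ⟨fun h => ?_, fun h => ?_⟩⟩,
    ⟨PotBurgers.classP1ext_isNormalizedGen, fun A O hA hS hO => ⟨fun h => ?_, fun h => ?_⟩⟩, ?_⟩
  · exact h.isExplicit (C := PotBurgers.classP1) (fun _ h => h) (fun _ _ => one_ne_zero) hO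
  · exact h.isGenEquiv (C := PotBurgers.classP1) (fun _ h => h) (fun _ _ => one_ne_zero) hA hS
  · exact h.isExplicit (C := PotBurgers.classP1ext) (fun _ h => h.1) (fun _ h => h.2) hO
  · exact h.isGenEquiv (C := PotBurgers.classP1ext) (fun _ h => h.1) (fun _ h => h.2) hA hS
  · intro f lam f' lam' φ Ω P k F0 _ _ _ hΩ hne h P'
    constructor
    · rintro ⟨k', F0', h'⟩
      exact h.params_unique hΩ hne h'
    · rintro ⟨c, hc, rfl⟩
      exact ⟨_, _, h.scale hc⟩
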